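/- Setting. Let $\Phi$ be a simple point process in $\mathbb R^2$ with intensity $\lambda>0$ and isotropic pair correlation function $g\ge 0$: $\mathbb E\,\Phi(A)=\lambda\,\nu(A)$, and the mean number of ordered pairs of distinct points $(x,y)$ of $\Phi$ with $x\in A$, $y\in D$ is $\lambda^2\int_A\int_D g(\|x-y\|)\,dy\,dx$, for all bounded Borel sets $A,D$ ($\nu$ is the area). Suppose that $g$ is Borel and bounded and that $x\mapsto g(\|x\|)$ is continuous at almost every $x\in\mathbb R^2$. Let $B=[-\delta/2,\delta/2)^2$, let $x_1,\dots,x_n$ be distinct points of a square grid of mesh $\delta$ (a translate of $\delta\mathbb Z^2$), $B_i=x_i\oplus B$, and let $S=\bigcup_{i=1}^n B_i$ be the observation window, so $n=\nu(S)/\nu(B)$. For a location $x_o$ put $C=(\operatorname{cov}(\Phi(B_i),\Phi(B_j)))_{i,j}$, $C_o=(\operatorname{cov}(\Phi(B_i),\Phi(x_o\oplus B)))_i$, $\mathbf 1=(1,\dots,1)^T\in\mathbb R^n$, and let $$\widehat\lambda(x_o)=\sum_{i=1}^n\mu_i\frac{\Phi(B_i)}{\nu(B)},\qquad \mu=C^{-1}C_o+\frac{1-\mathbf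 1^TC^{-1}C_o}{\mathbf 1^TC^{-1}\mathbf 1}\,C^{-1}\mathbf 1,$$ be the ordinary kriging interpolator of the local intensity at $x_o$. For $y,z\in S$ let $H^1(y,z)=g(\|y-z\|)-1$, $H^{k+1}(y,z)=\int_S (g(\|y-x\|)-1)\,H^k(x,z)\,dx$, and $$J_\lambda(y,z)=\sum_{k\ge1}(-1)^k\lambda^{k-1}H^k(y,z);$$ write also $J_\lambda$ for the $n\times n$ matrix $(J_\lambda(x_i,x_j))_{i,j}$. Let $G_o-1$ be the $n$-vector with entries $g_{io}-1$, $g_{io}=\nu(B)^{-2}\int_B\int_B g(\|x_i-x_o+u-v\|)\,du\,dv$. Proposition. (1) Estimation. If $x_o$ is one of the grid points $x_i$ of the observation window and $C$ is invertible, then $\operatorname{Var}\widehat\lambda(x_o)\approx\lambda/\nu(B)$ as $B\to0$: for every $\varepsilon>0$ there is $\delta_1>0$ such that $$\left|\frac{\operatorname{Var}\widehat\lambda(x_o)}{\lambda/\nu(B)}-1\right|<\varepsilon$$ whenever $0<\delta<\delta_1$; here $\delta_1$ does not depend on the grid, on the window $S$, or on $x_o$. (2) Prediction. Let $S\neq\emptyset$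 be a window for which the series $J_\lambda(y,z)$ converges absolutely for all $y,z\in S$, and let $$V(x_o)=\lambda^3\nu(B)\,(G_o-1)^T(G_o-1)+\lambda^4\nu(B)^2\,(G_o-1)^TJ_\lambda(G_o-1)+\frac{1-\big[\lambda\nu(B)\mathbf 1^T(G_o-1)+\lambda^2\nu(B)^2\mathbf 1^TJ_\lambda(G_o-1)\big]^2}{\frac{\nu(S)}{\lambda}+\nu(B)^2\,\mathbf 1^TJ_\lambda\mathbf 1}.$$ Then for every $\varepsilon>0$ there is $\delta_0>0$ such that for every grid of mesh $\delta<\delta_0$ for which $S$ is a union of cells $B_i$ as above: $C$ is invertible, and for every $x_o$ outside the window, in the sense that $(x_o\oplus B)\cap S=\emptyset$, $$\big|\operatorname{Var}\widehat\lambda(x_o)-V(x_o)\big|<\varepsilon\qquad\text{and}\qquad \big|\operatorname{Var}\widehat\lambda(x_o)-V(x_o)\big|<\varepsilon\,\operatorname{Var}\widehat\lambda(x_o).$$ -/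

import Mathlib

open MeasureTheory ProbabilityTheory

/-- The Euclidean plane. -/
abbrev Plane : Type := EuclideanSpace ℝ (Fin 2)

/-- A simple point process in the plane: a random locally finite set of points whose numbers of
points in bounded Borel sets are random variables. -/
structure PlanarPointProcess (Ω : Type*) [MeasurableSpace Ω] where
  /-- the random set of points -/
  pts : Ω → Set Plane
  finite_inter : ∀ ω A, Bornology.IsBounded A → (pts ω ∩ A).Finite
  measurable_count : ∀ A, Bornology.IsBounded A → MeasurableSet A →
    Measurable fun ω => (pts ω ∩ A).ncard

namespace PlanarPointProcess

variable {Ω : Type*} [MeasurableSpace Ω]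

/-- `Φ(A)`, the number of points in the bounded set `A`. -/
noncomputable def count (Φ : PlanarPointProcess Ω) (A : Set Plane) (ω : Ω) : ℝ :=
  ((Φ.pts ω ∩ A).ncard : ℝ)

/-- `Φ` has intensity `lam`: the mean number of points in `A` is `lam` times the area of `A`. -/
def HasIntensity (Φ : PlanarPointProcess Ω) (P : Measure Ω) (lam : ℝ) : Prop :=
  ∀ A : Set Plane, Bornology.IsBounded A → MeasurableSet A →
    ∫⁻ ω, ((Φ.pts ω ∩ A).ncard : ENNReal) ∂P = ENNReal.ofReal lam * volume A

/-- `g` is the (isotropic) pair correlation function of the process `Φ` of intensity `lam`: the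
second factorial moment measure, that is the mean number of ordered pairs of distinct points
`(x, y)` of the process with `x ∈ A`, `y ∈ D`, has density `lam ^ 2 * g ‖x - y‖`. -/
def HasPairCorrelation (Φ : PlanarPointProcess Ω) (P : Measure Ω) (lam : ℝ) (g : ℝ → ℝ) : Prop :=
  ∀ A D : Set Plane, Bornology.IsBounded A → MeasurableSet A →
    Bornology.IsBounded D → MeasurableSet D →
    ∫⁻ ω, (({p : Plane × Plane |
        p.1 ∈ Φ.pts ω ∩ A ∧ p.2 ∈ Φ.pts ω ∩ D ∧ p.1 ≠ p.2}.ncard : ℕ) : ENNReal) ∂P =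
      ENNReal.ofReal (lam ^ 2) *
        ∫⁻ x in A, ∫⁻ y in D, ENNReal.ofReal (g ‖x - y‖)

end PlanarPointProcess

/-- The elementary square `x ⊕ B` of side `δ` centred at `x` (half-open, so that neighbouring
squares of a grid are disjoint). -/
def gridCell (δ : ℝ) (x : Plane) : Set Plane :=
  {y | ∀ j : Fin 2, y j - x j ∈ Set.Ico (-(δ / 2)) (δ / 2)}

/-- The point with integer coordinates `i` of the square grid of mesh `δ` through `a`. -/
noncomputable def gridNode (δ : ℝ) (a : Plane) (i : ℤ × ℤ) : Plane :=
  !₂[a 0 + δ * i.1, a 1 + δ * i.2]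

/-- The union of the elementary squares centred at the grid points with index in `I`. -/
def gridWindow (δ : ℝ) (a : Plane) (I : Finset (ℤ × ℤ)) : Set Plane :=
  ⋃ i ∈ I, gridCell δ (gridNode δ a i)

/-- `ν(B)`, the area of an elementary square. -/
noncomputable def cellArea (δ : ℝ) : ℝ := volume.real (gridCell δ 0)

section Kriging

variable {Ω : Type*} [MeasurableSpace Ω]

/-- The covariance matrix `C` of the counts `Φ(B_i)`. -/
noncomputable def covMatrix (Φ : PlanarPointProcess Ω) (P : Measure Ω)
    (δ : ℝ) (a : Plane) (I : Finset (ℤ × ℤ)) : Matrix I I ℝ :=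
  Matrix.of fun i j =>
    covariance (Φ.count (gridCell δ (gridNode δ a i))) (Φ.count (gridCell δ (gridNode δ a j))) P

/-- The vector `C_o` of covariances of the counts `Φ(B_i)` with `Φ(x_o ⊕ B)`. -/
noncomputable def covVector (Φ : PlanarPointProcess Ω) (P : Measure Ω)
    (δ : ℝ) (a : Plane) (I : Finset (ℤ × ℤ)) (xo : Plane) : I → ℝ :=
  fun i => covariance (Φ.count (gridCell δ (gridNode δ a i))) (Φ.count (gridCell δ xo)) P

/-- The ordinary kriging weights
`μ = C⁻¹ C_o + (1 - 1ᵀ C⁻¹ C_o) / (1ᵀ C⁻¹ 1) • C⁻¹ 1`. -/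
noncomputable def krigingWeights (Φ : PlanarPointProcess Ω) (P : Measure Ω)
    (δ : ℝ) (a : Plane) (I : Finset (ℤ × ℤ)) (xo : Plane) : I → ℝ :=
  let C := covMatrix Φ P δ a I
  let Co := covVector Φ P δ a I xo
  let one : I → ℝ := fun _ => 1
  C⁻¹.mulVec Co +
    ((1 - one ⬝ᵥ C⁻¹.mulVec Co) / (one ⬝ᵥ C⁻¹.mulVec one)) • C⁻¹.mulVec one

/-- The kriging interpolator `∑ i, μ_i Φ(B_i) / ν(B)` of the local intensity at `xo`. -/
noncomputable def krigingInterpolator (Φ : PlanarPointProcess Ω) (P : Measure Ω)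
    (δ : ℝ) (a : Plane) (I : Finset (ℤ × ℤ)) (xo : Plane) : Ω → ℝ :=
  fun ω => ∑ i : I, krigingWeights Φ P δ a I xo i *
    (Φ.count (gridCell δ (gridNode δ a i)) ω / cellArea δ)

end Kriging

/-- `iterKernel g S k` is the iterated kernel `H^(k+1)` of `g - 1` over `S`:
`H^1(y, z) = g ‖y - z‖ - 1` and `H^(k+1)(y, z) = ∫_S (g ‖y - x‖ - 1) H^k(x, z) dx`. -/
noncomputable def iterKernel (g : ℝ → ℝ) (S : Set Plane) : ℕ → Plane → Plane → ℝ
  | 0 => fun y z => g ‖y - z‖ - 1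
  | k + 1 => fun y z => ∫ x in S, (g ‖y - x‖ - 1) * iterKernel g S k x z

/-- The `k`-th term, `k = 0, 1, …`, of the series
`J(y, z) = ∑_{k ≥ 1} (-1)^k lam^(k-1) H^k(y, z)`, with the index shifted by one. -/
noncomputable def neumannTerm (lam : ℝ) (g : ℝ → ℝ) (S : Set Plane) (y z : Plane) (k : ℕ) : ℝ :=
  (-1) ^ (k + 1) * lam ^ k * iterKernel g S k y z

/-- The matrix `J`, with entries `J(x_i, x_j)` at the grid points. -/
noncomputable def neumannMatrix (lam : ℝ) (g : ℝ → ℝ)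
    (δ : ℝ) (a : Plane) (I : Finset (ℤ × ℤ)) : Matrix I I ℝ :=
  Matrix.of fun i j =>
    ∑' k, neumannTerm lam g (gridWindow δ a I) (gridNode δ a i) (gridNode δ a j) k

/-- The vector `G_o - 1`, where `G_o` has the entries
`g_io = ν(B)⁻² ∫_{B × B} g ‖x_i - x_o + u - v‖ du dv`. -/
noncomputable def pairVector (g : ℝ → ℝ) (δ : ℝ) (a : Plane) (I : Finset (ℤ × ℤ))
    (xo : Plane) : I → ℝ :=
  fun i => 1 / cellArea δ ^ 2 *
    (∫ u in gridCell δ 0, ∫ v in gridCell δ 0, g ‖gridNode δ a i - xo + u - v‖) - 1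

/-- The variance formula outside the window. -/
noncomputable def predictionVariance (lam : ℝ) (g : ℝ → ℝ)
    (δ : ℝ) (a : Plane) (I : Finset (ℤ × ℤ)) (xo : Plane) : ℝ :=
  let b := cellArea δ
  let d := pairVector g δ a I xo
  let J := neumannMatrix lam g δ a I
  let one : I → ℝ := fun _ => 1
  lam ^ 3 * b * (d ⬝ᵥ d) + lam ^ 4 * b ^ 2 * (d ⬝ᵥ J.mulVec d) +
    (1 - (lam * b * (one ⬝ᵥ d) + lam ^ 2 * b ^ 2 * (one ⬝ᵥ J.mulVec d)) ^ 2) /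
      (volume.real (gridWindow δ a I) / lam + b ^ 2 * (one ⬝ᵥ J.mulVec one))

/-! Write `b` for the cell area, `κ = lam * (g - 1)` and `R = lam * J`, so that `R` is the Neumann
series of `κ` and `(1 + κ)(1 + R) = 1` as operators on `S`. Distinct cells are disjoint, so `C = lam
* b * (1 + A)`, where `A` has entries `b` times the means of `κ` over products of cells.

Estimation: at a grid point `C_o` is a column of `C`, the weights are a unit vector, and the
variance is `C i i / b ^ 2`. Since `κ` is bounded, this is `lam / b` up to a relative error of order
`b`, whatever the grid (`variance_krigingInterpolator_gridNode`).

Prediction: the variance is an explicit function of three quadratic forms in `(1 + A)⁻¹`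
(`kriging_quadratic_form`), and `V` is the same function with `1 + L` in its place, where `L` has
entries `b * R(x_i, x_j)` (`predictionVariance_eq`). Now `(1 + A)(1 + L) = 1 + N`, with `N` the
error made by discretising the resolvent equation. The Frobenius norm of `N` is the `L²` norm over
`S × S` of a step function that tends to zero by dominated convergence, because `κ` is continuous
almost everywhere (`exists_gridDefect_lt`). A small `N` makes `1 + A` invertible with an inverse
bounded independently of the number of cells and close to `1 + L`; the factor `b` in the forms
balances the squared length, of order `1 / b`, of the vectors involved.

Dominated convergence needs a bounded `R`, whereas only pointwise convergence of the series is
assumed. Symmetry of `κ` closes the gap: its even powers have nonnegative diagonals, convex in the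
exponent, so their convergence to zero is monotone, the traces tend to zero, and Cauchy-Schwarz
yields uniform geometric decay (`exists_kernelPow_geometric`).

The relative estimate follows from the absolute one because the variance is bounded below by a
positive constant (`div_le_kriging_formula`). -/

open Filter Topology

set_option linter.unusedSectionVars false

/-! ### Iterates of a bounded symmetric kernel: from pointwise to geometric decay. -/

section IteratedKernel

lemma MeasureTheory.Integrable.of_abs_le {X : Type*} [MeasurableSpace X] {μ : Measure X}
    [IsFiniteMeasure μ] {f : X → ℝ} (hf : Measurable f) {c : ℝ} (hc : ∀ x, |f x| ≤ c) :
    Integrable f μ :=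
  .of_bound hf.aestronglyMeasurable c (.of_forall hc)

/-- The Cauchy-Schwarz inequality for square integrable functions. -/
lemma MeasureTheory.sq_integral_mul_le {X : Type*} [MeasurableSpace X] {μ : Measure X}
    {f g : X → ℝ} (hff : Integrable (fun x => f x ^ 2) μ) (hgg : Integrable (fun x => g x ^ 2) μ)
    (hfg : Integrable (fun x => f x * g x) μ) :
    (∫ x, f x * g x ∂μ) ^ 2 ≤ (∫ x, f x ^ 2 ∂μ) * ∫ x, g x ^ 2 ∂μ := by
  have h := discrim_le_zero (a := ∫ x, f x ^ 2 ∂μ) (b := 2 * ∫ x, f x * g x ∂μ)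
    (c := ∫ x, g x ^ 2 ∂μ) fun t => by
      have h0 : 0 ≤ ∫ x, (t * f x + g x) ^ 2 ∂μ := integral_nonneg fun x => sq_nonneg _
      have h1 : ∫ x, (t * f x + g x) ^ 2 ∂μ
          = ∫ x, (t * t) * f x ^ 2 + ((2 * t) * (f x * g x) + g x ^ 2) ∂μ := by
        congr 1; ext x; ring
      have h2 : Integrable (fun x => 2 * t * (f x * g x) + g x ^ 2) μ := (hfg.const_mul _).add hgg
      rw [h1, integral_add (hff.const_mul _) h2,
        integral_add (hfg.const_mul _) hgg, integral_const_mul, integral_const_mul] at h0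
      linarith
  rw [discrim] at h
  linarith

/-- A convex sequence that tends to zero is antitone. -/
lemma antitone_of_convex_of_tendsto_zero {u : ℕ → ℝ} (hconv : ∀ k, 2 * u (k + 1) ≤ u (k + 2) + u k)
    (hlim : Tendsto u atTop (𝓝 0)) : Antitone u := by
  -- By convexity the increments increase, and they tend to zero, so none is positive.
  have hmono : Monotone fun k => u (k + 1) - u k :=
    monotone_nat_of_le_succ fun k => by have := hconv k; simp only [add_assoc]; norm_num; linarith
  have hd : Tendsto (fun k => u (k + 1) - u k) atTop (𝓝 0) := by
    simpa using (hlim.comp (tendsto_add_atTop_nat 1)).sub hlim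
  exact antitone_nat_of_succ_le fun k => by have := hmono.ge_of_tendsto hd k; linarith

variable {X : Type*} [MeasurableSpace X]

/-- `kernelPow μ κ k` is the `k + 1`-st iterate of the kernel `κ` with respect to `μ`. -/
noncomputable def kernelPow (μ : Measure X) (κ : X → X → ℝ) : ℕ → X → X → ℝ
  | 0 => κ
  | k + 1 => fun y z => ∫ x, κ y x * kernelPow μ κ k x z ∂μ

variable {μ : Measure X} [IsFiniteMeasure μ] {κ : X → X → ℝ} {c : ℝ}

lemma measurable_integral_mul {f g : X → X → ℝ} (hf : Measurable (Function.uncurry f))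
    (hg : Measurable (Function.uncurry g)) :
    Measurable (Function.uncurry fun y z => ∫ x, f y x * g x z ∂μ) := by
  have : Measurable fun p : (X × X) × X => f p.1.1 p.2 * g p.2 p.1.2 :=
    (hf.comp (by fun_prop : Measurable fun p : (X × X) × X => (p.1.1, p.2))).mul
      (hg.comp (by fun_prop : Measurable fun p : (X × X) × X => (p.2, p.1.2)))
  exact this.stronglyMeasurable.integral_prod_right'.measurable

lemma measurable_kernelPow (hm : Measurable (Function.uncurry κ)) (k : ℕ) :
    Measurable (Function.uncurry (kernelPow μ κ k)) := by
  induction k with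
  | zero => exact hm
  | succ k ih => exact measurable_integral_mul hm ih

lemma abs_integral_mul_le {f g : X → ℝ} {a b : ℝ} (hf : ∀ x, |f x| ≤ a) (hg : ∀ x, |g x| ≤ b) :
    |∫ x, f x * g x ∂μ| ≤ a * b * μ.real Set.univ := by
  rw [← Real.norm_eq_abs]
  refine norm_integral_le_of_norm_le_const (.of_forall fun x => ?_)
  rw [Real.norm_eq_abs, abs_mul]
  exact mul_le_mul (hf x) (hg x) (abs_nonneg _) ((abs_nonneg _).trans (hf x))

lemma exists_abs_kernelPow_le (hb : ∀ y z, |κ y z| ≤ c) (k : ℕ) :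
    ∃ D, ∀ y z, |kernelPow μ κ k y z| ≤ D := by
  induction k with
  | zero => exact ⟨c, hb⟩
  | succ k ih =>
    obtain ⟨D, hD⟩ := ih
    exact ⟨c * D * μ.real Set.univ, fun y z => abs_integral_mul_le (hb y) fun x => hD x z⟩

lemma integrable_kernelPow_mul (hm : Measurable (Function.uncurry κ)) (hb : ∀ y z, |κ y z| ≤ c)
    (k l : ℕ) (y z : X) :
    Integrable (fun x => kernelPow μ κ k y x * kernelPow μ κ l x z) μ := by
  obtain ⟨D, hD⟩ := exists_abs_kernelPow_le (μ := μ) hb k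
  obtain ⟨E, hE⟩ := exists_abs_kernelPow_le (μ := μ) hb l
  have h1 : Measurable fun x => kernelPow μ κ k y x :=
    (measurable_kernelPow hm k).comp measurable_prodMk_left
  have h2 : Measurable fun x => kernelPow μ κ l x z :=
    (measurable_kernelPow hm l).comp measurable_prodMk_right
  refine .of_abs_le (c := D * E) (h1.mul h2) fun x => ?_
  rw [abs_mul]
  exact mul_le_mul (hD _ _) (hE _ _) (abs_nonneg _) ((abs_nonneg _).trans (hD y x))

/-- Index `k` stands for the power `k + 1`, hence the extra one in the sum of indices. -/
lemma kernelPow_add (hm : Measurable (Function.uncurry κ)) (hb : ∀ y z, |κ y z| ≤ c)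
    (k l : ℕ) (y z : X) :
    kernelPow μ κ (k + l + 1) y z = ∫ x, kernelPow μ κ k y x * kernelPow μ κ l x z ∂μ := by
  induction k generalizing y z with
  | zero => rw [zero_add]; rfl
  | succ k ih =>
    obtain ⟨D, hD⟩ := exists_abs_kernelPow_le (μ := μ) hb k
    obtain ⟨E, hE⟩ := exists_abs_kernelPow_le (μ := μ) hb l
    have e : k + 1 + l + 1 = (k + l + 1) + 1 := by ring
    rw [e]
    calc ∫ x, κ y x * kernelPow μ κ (k + l + 1) x z ∂μ
        = ∫ x, ∫ w, κ y x * (kernelPow μ κ k x w * kernelPow μ κ l w z) ∂μ ∂μ := by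
          simp_rw [ih, integral_const_mul]
      _ = ∫ w, ∫ x, κ y x * (kernelPow μ κ k x w * kernelPow μ κ l w z) ∂μ ∂μ := by
          refine integral_integral_swap (.of_abs_le (c := c * (D * E)) ?_ fun p => ?_)
          · exact (hm.comp (by fun_prop : Measurable fun p : X × X => (y, p.1))).mul
              ((measurable_kernelPow hm k).mul ((measurable_kernelPow hm l).comp
                (by fun_prop : Measurable fun p : X × X => (p.2, z))))
          · have hc : 0 ≤ c := (abs_nonneg _).trans (hb y y)
            have hD0 : 0 ≤ D := (abs_nonneg _).trans (hD y y)
            simp only [Function.uncurry, abs_mul]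
            gcongr
            · exact hb _ _
            · exact hD _ _
            · exact hE _ _
      _ = _ := by
          congr 1; ext w
          simp_rw [← mul_assoc, integral_mul_const]
          rfl

lemma kernelPow_symm (hm : Measurable (Function.uncurry κ)) (hb : ∀ y z, |κ y z| ≤ c)
    (hs : ∀ y z, κ y z = κ z y) (k : ℕ) (y z : X) :
    kernelPow μ κ k y z = kernelPow μ κ k z y := by
  induction k generalizing y z with
  | zero => exact hs y z
  | succ k ih =>
    -- The recursion peels a factor off on the left; splitting at `l = 0` peels it off on the right.
    rw [show k + 1 = k + 0 + 1 from rfl, kernelPow_add hm hb k 0 z y]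
    change ∫ x, κ y x * kernelPow μ κ k x z ∂μ = ∫ x, kernelPow μ κ k z x * κ x y ∂μ
    congr 1; ext x
    rw [hs y x, ih x z, mul_comm]

lemma integral_kernelPow_sq (hm : Measurable (Function.uncurry κ)) (hb : ∀ y z, |κ y z| ≤ c)
    (hs : ∀ y z, κ y z = κ z y) (k : ℕ) (y : X) :
    ∫ x, kernelPow μ κ k y x ^ 2 ∂μ = kernelPow μ κ (2 * k + 1) y y := by
  rw [two_mul, kernelPow_add hm hb]
  congr 1; ext x
  rw [kernelPow_symm hm hb hs k x y, sq]

/-- This is the expanded square of the `L²` distance between the iterates `k + 2` and `k` at `y`;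
odd indices are even powers, whose diagonal values are squared norms. -/
lemma kernelPow_odd_convex (hm : Measurable (Function.uncurry κ)) (hb : ∀ y z, |κ y z| ≤ c)
    (hs : ∀ y z, κ y z = κ z y) (y : X) (k : ℕ) :
    2 * kernelPow μ κ (2 * (k + 1) + 1) y y ≤
      kernelPow μ κ (2 * (k + 2) + 1) y y + kernelPow μ κ (2 * k + 1) y y := by
  have hsymm := kernelPow_symm (μ := μ) hm hb hs
  have hint : ∀ i j, Integrable (fun x => kernelPow μ κ i y x * kernelPow μ κ j y x) μ := by
    intro i j
    simpa only [hsymm j _ y] using integrable_kernelPow_mul (μ := μ) hm hb i j y y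
  have h0 : 0 ≤ ∫ x, (kernelPow μ κ (k + 2) y x - kernelPow μ κ k y x) ^ 2 ∂μ :=
    integral_nonneg fun x => sq_nonneg _
  have h1 : ∫ x, (kernelPow μ κ (k + 2) y x - kernelPow μ κ k y x) ^ 2 ∂μ =
      ∫ x, (kernelPow μ κ (k + 2) y x * kernelPow μ κ (k + 2) y x
        - 2 * (kernelPow μ κ (k + 2) y x * kernelPow μ κ k y x)
        + kernelPow μ κ k y x * kernelPow μ κ k y x) ∂μ := by
    congr 1; ext x; ring
  have h2 : Integrable (fun x => kernelPow μ κ (k + 2) y x * kernelPow μ κ (k + 2) y x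
      - 2 * (kernelPow μ κ (k + 2) y x * kernelPow μ κ k y x)) μ :=
    (hint _ _).sub ((hint _ _).const_mul 2)
  rw [h1, integral_add h2 (hint _ _),
    integral_sub (hint _ _) ((hint _ _).const_mul 2), integral_const_mul] at h0
  have hprod : ∀ i j, ∫ x, kernelPow μ κ i y x * kernelPow μ κ j y x ∂μ
      = kernelPow μ κ (i + j + 1) y y := by
    intro i j
    rw [kernelPow_add hm hb]
    simp only [hsymm j _ y]
  rw [hprod, hprod, hprod, show k + 2 + (k + 2) + 1 = 2 * (k + 2) + 1 by ring,
    show k + 2 + k + 1 = 2 * (k + 1) + 1 by ring, show k + k + 1 = 2 * k + 1 by ring] at h0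
  linarith

lemma sq_kernelPow_add_le (hm : Measurable (Function.uncurry κ)) (hb : ∀ y z, |κ y z| ≤ c)
    (hs : ∀ y z, κ y z = κ z y) (k l : ℕ) (y z : X) :
    kernelPow μ κ (k + l + 1) y z ^ 2 ≤
      kernelPow μ κ (2 * k + 1) y y * kernelPow μ κ (2 * l + 1) z z := by
  have hsymm := kernelPow_symm (μ := μ) hm hb hs
  have hint : ∀ i w, Integrable (fun x => kernelPow μ κ i w x ^ 2) μ := by
    intro i w
    simpa only [hsymm i _ w, ← sq] using integrable_kernelPow_mul (μ := μ) hm hb i i w w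
  rw [kernelPow_add hm hb, ← integral_kernelPow_sq hm hb hs, ← integral_kernelPow_sq hm hb hs]
  simp only [hsymm l _ z]
  refine sq_integral_mul_le (hint k y) (hint l z) ?_
  simpa only [hsymm l _ z] using integrable_kernelPow_mul (μ := μ) hm hb k l y z

/-- No bound uniform in `k` is known beforehand. Convexity makes the odd diagonal values decrease,
so the first of them dominates all the others. -/
lemma tendsto_integral_kernelPow_diag (hm : Measurable (Function.uncurry κ))
    (hb : ∀ y z, |κ y z| ≤ c) (hs : ∀ y z, κ y z = κ z y)
    (hlim : ∀ᵐ y ∂μ, Tendsto (fun k => kernelPow μ κ k y y) atTop (𝓝 0)) :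
    Tendsto (fun k => ∫ y, kernelPow μ κ (2 * k + 1) y y ∂μ) atTop (𝓝 0) := by
  obtain ⟨D, hD⟩ := exists_abs_kernelPow_le (μ := μ) hb 1
  have hmeas : ∀ k, Measurable fun y => kernelPow μ κ k y y := fun k =>
    (measurable_kernelPow hm k).comp (by fun_prop : Measurable fun y : X => (y, y))
  have hodd : Tendsto (fun k : ℕ => 2 * k + 1) atTop atTop :=
    tendsto_atTop_mono (fun k => by simp only [id]; omega) tendsto_id
  have := tendsto_integral_of_dominated_convergence (μ := μ)
    (F := fun k y => kernelPow μ κ (2 * k + 1) y y) (f := fun _ => 0) (fun _ => D)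
    (fun k => (hmeas _).aestronglyMeasurable) (integrable_const D) ?_ ?_
  · simpa using this
  · intro k
    filter_upwards [hlim] with y hy
    have hanti : Antitone fun k => kernelPow μ κ (2 * k + 1) y y :=
      antitone_of_convex_of_tendsto_zero (kernelPow_odd_convex hm hb hs y) (hy.comp hodd)
    have h0 : 0 ≤ kernelPow μ κ (2 * k + 1) y y := by
      rw [← integral_kernelPow_sq hm hb hs]; exact integral_nonneg fun x => sq_nonneg _
    rw [Real.norm_eq_abs, abs_of_nonneg h0]
    exact (hanti (Nat.zero_le k)).trans ((le_abs_self _).trans (hD y y))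
  · filter_upwards [hlim] with y hy using hy.comp hodd

/-- If the iterates of a bounded symmetric kernel tend to zero on the diagonal, then some iterate
is uniformly small. -/
lemma exists_kernelPow_le_of_tendsto_diag (hm : Measurable (Function.uncurry κ))
    (hb : ∀ y z, |κ y z| ≤ c) (hs : ∀ y z, κ y z = κ z y)
    (hlim : ∀ᵐ y ∂μ, Tendsto (fun k => kernelPow μ κ k y y) atTop (𝓝 0)) {ε : ℝ} (hε : 0 < ε) :
    ∃ m, ∀ y z, |kernelPow μ κ m y z| ≤ ε := by
  obtain ⟨D, hD⟩ := exists_abs_kernelPow_le (μ := μ) hb 1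
  have hlim' : Tendsto (fun k => D ^ 2 * ∫ y, kernelPow μ κ (2 * k + 1) y y ∂μ) atTop (𝓝 0) := by
    simpa using (tendsto_integral_kernelPow_diag hm hb hs hlim).const_mul (D ^ 2)
  obtain ⟨m, hm'⟩ := (hlim'.eventually (gt_mem_nhds (show (0 : ℝ) < ε ^ 2 by positivity))).exists
  -- Cauchy-Schwarz is used twice: once to pass to the diagonal, with one factor at most `D`, and
  -- once inside `h1` to bound the other factor by `D` times a small trace.
  refine ⟨m + 1 + 0 + 1, fun y z => abs_le_of_sq_le_sq ?_ hε.le⟩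
  have hD0 : 0 ≤ D := (abs_nonneg _).trans (hD y y)
  have hα : 0 ≤ ∫ y, kernelPow μ κ (2 * m + 1) y y ∂μ := integral_nonneg fun y => by
    rw [← integral_kernelPow_sq hm hb hs]; exact integral_nonneg fun x => sq_nonneg _
  have h1 : kernelPow μ κ (2 * (m + 1) + 1) y y
      ≤ D * ∫ x, kernelPow μ κ (2 * m + 1) x x ∂μ := by
    rw [← integral_kernelPow_sq hm hb hs, ← integral_const_mul]
    have hmeas : Measurable fun x => kernelPow μ κ (2 * m + 1) x x :=
      (measurable_kernelPow (μ := μ) hm (2 * m + 1)).comp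
        (by fun_prop : Measurable fun y : X => (y, y))
    obtain ⟨E, hE⟩ := exists_abs_kernelPow_le (μ := μ) hb (2 * m + 1)
    refine integral_mono_of_nonneg (.of_forall fun x => sq_nonneg _)
      ((Integrable.of_abs_le hmeas fun x => hE x x).const_mul D) (.of_forall fun x => ?_)
    have h := sq_kernelPow_add_le (μ := μ) hm hb hs 0 m y x
    rw [zero_add] at h
    refine h.trans (mul_le_mul_of_nonneg_right ((le_abs_self _).trans (hD y y)) ?_)
    rw [← integral_kernelPow_sq hm hb hs]; exact integral_nonneg fun x => sq_nonneg _
  calc kernelPow μ κ (m + 1 + 0 + 1) y z ^ 2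
      ≤ kernelPow μ κ (2 * (m + 1) + 1) y y * kernelPow μ κ (2 * 0 + 1) z z :=
        sq_kernelPow_add_le hm hb hs (m + 1) 0 y z
    _ ≤ (D * ∫ x, kernelPow μ κ (2 * m + 1) x x ∂μ) * D := by
        refine mul_le_mul h1 ((le_abs_self _).trans (hD z z)) ?_ (by positivity)
        rw [← integral_kernelPow_sq hm hb hs]; exact integral_nonneg fun x => sq_nonneg _
    _ ≤ ε ^ 2 := by nlinarith

/-- If the iterates of a bounded symmetric kernel tend to zero on the diagonal, then they decay
geometrically, uniformly in both variables. -/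
lemma exists_kernelPow_geometric (hm : Measurable (Function.uncurry κ))
    (hb : ∀ y z, |κ y z| ≤ c) (hs : ∀ y z, κ y z = κ z y)
    (hlim : ∀ᵐ y ∂μ, Tendsto (fun k => kernelPow μ κ k y y) atTop (𝓝 0)) :
    ∃ D q : ℝ, 0 ≤ D ∧ 0 < q ∧ q < 1 ∧ ∀ k y z, |kernelPow μ κ k y z| ≤ D * q ^ k := by
  set V := μ.real Set.univ
  have hV : 0 ≤ V := measureReal_nonneg
  -- After integration over total mass `V` this bound gives a factor at most `1 / 2`, also when `V =
  -- 0`.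
  obtain ⟨m, hsmall⟩ := exists_kernelPow_le_of_tendsto_diag (μ := μ) hm hb hs hlim
    (show (0 : ℝ) < 1 / (2 * (V + 1)) by positivity)
  -- Composing with iterate `m` raises the index by `m + 1` and halves the bound, so `q` is the
  -- corresponding root of `1 / 2`.
  set q : ℝ := (1 / 2 : ℝ) ^ ((1 : ℝ) / ((m + 1 : ℕ) : ℝ)) with hq
  have hq0 : 0 < q := Real.rpow_pos_of_pos (by norm_num) _
  have hq1 : q < 1 := Real.rpow_lt_one (by norm_num) (by norm_num) (by positivity)
  have hqm : q ^ (m + 1) = 1 / 2 := by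
    rw [hq, ← Real.rpow_natCast, ← Real.rpow_mul (by norm_num), one_div_mul_cancel (by positivity),
      Real.rpow_one]
  choose B hB using exists_abs_kernelPow_le (μ := μ) hb
  set D0 : ℝ := ∑ k ∈ Finset.range (m + 1), |B k|
  have hD0 : 0 ≤ D0 := Finset.sum_nonneg fun k _ => abs_nonneg _
  -- The factor 2 compensates `q ^ k ≥ 1 / 2` for the initial indices.
  refine ⟨2 * D0, q, by positivity, hq0, hq1, fun k => ?_⟩
  induction k using Nat.strong_induction_on with
  | _ k ih =>
    intro y z
    by_cases hk : k < m + 1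
    · have h1 : |B k| ≤ D0 :=
        Finset.single_le_sum (f := fun k => |B k|) (fun _ _ => abs_nonneg _) (Finset.mem_range.2 hk)
      have h2 : 1 / 2 ≤ q ^ k := hqm ▸ pow_le_pow_of_le_one hq0.le hq1.le hk.le
      have h3 := (hB k y z).trans (le_abs_self _)
      nlinarith
    · obtain ⟨j, rfl⟩ : ∃ j, k = m + j + 1 := ⟨k - (m + 1), by omega⟩
      rw [kernelPow_add hm hb]
      refine (abs_integral_mul_le (hsmall y) fun x => ih j (by omega) x z).trans ?_
      rw [show m + j + 1 = j + (m + 1) by ring, pow_add, hqm]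
      have h1 : V / (V + 1) ≤ 1 := by rw [div_le_one (by positivity)]; linarith
      have h2 : 1 / (2 * (V + 1)) * (2 * D0 * q ^ j) * V
          = (2 * D0 * (q ^ j * (1 / 2))) * (V / (V + 1)) := by field_simp
      rw [h2]
      exact mul_le_of_le_one_right (by positivity) h1

end IteratedKernel

/-! ### The Neumann series as a resolvent kernel, and its discretisation defect. -/

section Resolvent

variable {X : Type*} [MeasurableSpace X]

/-- The alternating sum of the iterates of a kernel. -/
noncomputable def kernelResolvent (μ : Measure X) (κ : X → X → ℝ) (y z : X) : ℝ :=
  ∑' k, (-1) ^ (k + 1) * kernelPow μ κ k y z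

variable {μ : Measure X} [IsFiniteMeasure μ] {κ : X → X → ℝ} {c D q : ℝ}

/-- The kernel `κ` is measurable, bounded and symmetric, and its iterates decay geometrically. -/
structure GeometricKernel (μ : Measure X) (κ : X → X → ℝ) (c D q : ℝ) : Prop where
  measurable : Measurable (Function.uncurry κ)
  bound : ∀ y z, |κ y z| ≤ c
  symm : ∀ y z, κ y z = κ z y
  pos : 0 < q
  lt_one : q < 1
  geometric : ∀ k y z, |kernelPow μ κ k y z| ≤ D * q ^ k

namespace GeometricKernel

variable (h : GeometricKernel μ κ c D q)
include h

lemma abs_term_le (y z : X) (k : ℕ) : ‖(-1) ^ (k + 1) * kernelPow μ κ k y z‖ ≤ D * q ^ k := by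
  simpa [abs_mul] using h.geometric k y z

lemma hasSum_bound : HasSum (fun k => D * q ^ k) (D * (1 - q)⁻¹) :=
  (hasSum_geometric_of_lt_one h.pos.le h.lt_one).mul_left D

lemma hasSum_resolvent (y z : X) :
    HasSum (fun k => (-1) ^ (k + 1) * kernelPow μ κ k y z) (kernelResolvent μ κ y z) :=
  (Summable.of_norm_bounded h.hasSum_bound.summable (h.abs_term_le y z)).hasSum

lemma abs_resolvent_le (y z : X) : |kernelResolvent μ κ y z| ≤ D * (1 - q)⁻¹ :=
  tsum_of_norm_bounded h.hasSum_bound (h.abs_term_le y z)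

lemma resolvent_symm (y z : X) : kernelResolvent μ κ y z = kernelResolvent μ κ z y := by
  simp only [kernelResolvent, kernelPow_symm h.measurable h.bound h.symm _ y z]

lemma measurable_resolvent : Measurable (Function.uncurry (kernelResolvent μ κ)) := by
  refine measurable_of_tendsto_metrizable (f := fun n (p : X × X) =>
    ∑ k ∈ Finset.range n, (-1) ^ (k + 1) * kernelPow μ κ k p.1 p.2) (fun n => ?_) ?_
  · exact Finset.measurable_fun_sum _ fun k _ =>
      (measurable_kernelPow h.measurable k).const_mul _
  · exact tendsto_pi_nhds.2 fun p => (h.hasSum_resolvent p.1 p.2).tendsto_sum_nat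

/-- Applying `κ` to the alternating series shifts it by one and flips its sign; the geometric bound
permits integration term by term. -/
lemma resolvent_eq (y z : X) :
    kernelResolvent μ κ y z = -κ y z - ∫ x, κ y x * kernelResolvent μ κ x z ∂μ := by
  have hc : 0 ≤ c := (abs_nonneg _).trans (h.bound y y)
  have hbd : ∀ k x, ‖κ y x * ((-1) ^ (k + 1) * kernelPow μ κ k x z)‖ ≤ c * (D * q ^ k) := by
    intro k x
    rw [norm_mul]
    exact mul_le_mul (h.bound y x) (h.abs_term_le x z k) (norm_nonneg _) hc
  have hint : ∀ k, Integrable (fun x => κ y x * ((-1) ^ (k + 1) * kernelPow μ κ k x z)) μ :=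
    fun k => .of_abs_le ((h.measurable.comp measurable_prodMk_left).mul
      (((measurable_kernelPow h.measurable k).comp measurable_prodMk_right).const_mul _)) (hbd k)
  have hsum := hasSum_integral_of_summable_integral_norm hint (by
    refine Summable.of_nonneg_of_le (fun k => integral_nonneg fun x => norm_nonneg _) (fun k => ?_)
      ((h.hasSum_bound.summable.mul_left c).mul_right (μ.real Set.univ))
    have := norm_integral_le_of_norm_le_const (μ := μ)
      (f := fun x => ‖κ y x * ((-1) ^ (k + 1) * kernelPow μ κ k x z)‖)
      (.of_forall fun x => (norm_norm _).trans_le (hbd k x))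
    exact (Real.le_norm_self _).trans this)
  simp only [tsum_mul_left] at hsum
  have h1 := (h.hasSum_resolvent y z)
  rw [← hasSum_nat_add_iff' 1] at h1
  have h2 : HasSum (fun k => (-1) ^ (k + 1 + 1) * kernelPow μ κ (k + 1) y z)
      (-∫ x, κ y x * kernelResolvent μ κ x z ∂μ) := by
    have e : (fun k => (-1) ^ (k + 1 + 1) * kernelPow μ κ (k + 1) y z) =
        fun k => -∫ x, κ y x * ((-1) ^ (k + 1) * kernelPow μ κ k x z) ∂μ := by
      ext k
      rw [kernelPow, ← integral_neg, ← integral_const_mul]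
      refine integral_congr_ae (.of_forall fun x => ?_)
      simp only
      ring
    rw [e]
    exact hsum.neg
  have := h1.unique h2
  simp [kernelPow] at this
  linarith

lemma resolvent_eq' (y z : X) :
    kernelResolvent μ κ y z = -κ y z - ∫ x, kernelResolvent μ κ y x * κ x z ∂μ := by
  rw [h.resolvent_symm y z, h.resolvent_eq z y, h.symm z y]
  congr 1
  refine integral_congr_ae (.of_forall fun x => ?_)
  simp only
  rw [h.resolvent_symm x y, h.symm z x, mul_comm]

variable [TopologicalSpace X]

/-- The resolvent inherits continuity from `κ`: in `resolvent_eq'` the moving second variable enters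
only through `κ`. -/
lemma tendsto_resolvent_right {x z : X} {v : ℕ → X} (hv : Tendsto v atTop (𝓝 z))
    (hx : ContinuousAt (Function.uncurry κ) (x, z))
    (hcont : ∀ᵐ w ∂μ, ContinuousAt (Function.uncurry κ) (w, z)) :
    Tendsto (fun n => kernelResolvent μ κ x (v n)) atTop (𝓝 (kernelResolvent μ κ x z)) := by
  have key : ∀ w, ContinuousAt (Function.uncurry κ) (w, z) →
      Tendsto (fun n => κ w (v n)) atTop (𝓝 (κ w z)) := fun w hw =>
    hw.tendsto.comp (tendsto_const_nhds.prodMk_nhds hv)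
  have hK : 0 ≤ D * (1 - q)⁻¹ := (abs_nonneg _).trans (h.abs_resolvent_le x x)
  rw [funext fun n => h.resolvent_eq' x (v n), h.resolvent_eq' x z]
  refine (key x hx).neg.sub (tendsto_integral_of_dominated_convergence
    (fun _ => D * (1 - q)⁻¹ * c) (fun n => ?_) (integrable_const _)
    (fun n => .of_forall fun w => ?_) ?_)
  · exact ((h.measurable_resolvent.comp measurable_prodMk_left).mul
      (h.measurable.comp measurable_prodMk_right)).aestronglyMeasurable
  · rw [norm_mul]
    exact mul_le_mul (h.abs_resolvent_le _ _) (h.bound _ _) (norm_nonneg _) hK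
  · filter_upwards [hcont] with w hw using (key w hw).const_mul _

lemma continuousAt_swap {y z : X} (hc : ContinuousAt (Function.uncurry κ) (y, z)) :
    ContinuousAt (Function.uncurry κ) (z, y) := by
  have : Function.uncurry κ = Function.uncurry κ ∘ Prod.swap := by
    ext p; exact h.symm p.1 p.2
  rw [this]
  exact ContinuousAt.comp (x := (z, y)) (f := Prod.swap) hc continuous_swap.continuousAt

lemma tendsto_integral_mul_resolvent {y z : X} {γ ρ : ℕ → X → ℝ}
    (hγm : ∀ n, Measurable (γ n)) (hγ : ∀ n x, |γ n x| ≤ c)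
    (hγlim : ∀ᵐ x ∂μ, Tendsto (fun n => γ n x) atTop (𝓝 (κ y x)))
    (hρm : ∀ n, Measurable (ρ n)) (hρ : ∀ n x, |ρ n x| ≤ D * (1 - q)⁻¹)
    (hρlim : ∀ᵐ x ∂μ, Tendsto (fun n => ρ n x) atTop (𝓝 (kernelResolvent μ κ x z))) :
    Tendsto (fun n => ∫ x, γ n x * ρ n x ∂μ) atTop
      (𝓝 (-κ y z - kernelResolvent μ κ y z)) := by
  rw [h.resolvent_eq y z, sub_sub_cancel]
  have hc : 0 ≤ c := (abs_nonneg _).trans (h.bound y y)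
  refine tendsto_integral_of_dominated_convergence
    (fun _ => c * (D * (1 - q)⁻¹)) (fun n => ?_) (integrable_const _)
    (fun n => .of_forall fun w => ?_) ?_
  · exact ((hγm n).mul (hρm n)).aestronglyMeasurable
  · rw [norm_mul]
    exact mul_le_mul (hγ _ _) (hρ _ _) (norm_nonneg _) hc
  · filter_upwards [hγlim, hρlim] with w h1 h2 using h1.mul h2

/-- In `resolvent_eq` the first variable enters through `κ` alone, and the moving second one is
handled by `tendsto_resolvent_right`. -/
lemma tendsto_resolvent {y z : X} {u v : ℕ → X} (hu : Tendsto u atTop (𝓝 y))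
    (hv : Tendsto v atTop (𝓝 z)) (hyz : ContinuousAt (Function.uncurry κ) (y, z))
    (hcont : ∀ z, ∀ᵐ w ∂μ, ContinuousAt (Function.uncurry κ) (w, z)) :
    Tendsto (fun n => kernelResolvent μ κ (u n) (v n)) atTop (𝓝 (kernelResolvent μ κ y z)) := by
  have h1 : Tendsto (fun n => κ (u n) (v n)) atTop (𝓝 (κ y z)) :=
    hyz.tendsto.comp (hu.prodMk_nhds hv)
  have h2 := h.tendsto_integral_mul_resolvent (y := y) (z := z) (γ := fun n x => κ (u n) x)
    (ρ := fun n x => kernelResolvent μ κ x (v n))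
    (fun n => h.measurable.comp measurable_prodMk_left) (fun n x => h.bound _ _)
    (by
      filter_upwards [hcont y] with x hx
      exact (h.continuousAt_swap hx).tendsto.comp (hu.prodMk_nhds tendsto_const_nhds))
    (fun n => h.measurable_resolvent.comp measurable_prodMk_right)
    (fun n x => h.abs_resolvent_le _ _)
    (by
      filter_upwards [hcont z] with x hx
      exact h.tendsto_resolvent_right hv hx (hcont z))
  simp only [h.resolvent_eq (u _) (v _)]
  convert h1.neg.sub h2 using 2
  ring

/-- The defect of the resolvent equation when kernel and resolvent are replaced by the
approximations `γ` and `kernelResolvent μ κ (p y) (p z)`. -/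
noncomputable def _root_.resolventDefect (μ : Measure X) (κ γ : X → X → ℝ) (p : X → X) (y z : X) :
    ℝ :=
  γ y z + kernelResolvent μ κ (p y) (p z) + ∫ x, γ y x * kernelResolvent μ κ (p x) (p z) ∂μ

/-- The three terms converge to those of the exact resolvent equation, whose sum is zero. -/
lemma tendsto_resolventDefect {γ : ℕ → X → X → ℝ} {p : ℕ → X → X} {y z : X}
    (hγm : ∀ n, Measurable (Function.uncurry (γ n))) (hγ : ∀ n x y, |γ n x y| ≤ c)
    (hpm : ∀ n, Measurable (p n))
    (hcont : ∀ z, ∀ᵐ w ∂μ, ContinuousAt (Function.uncurry κ) (w, z))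
    (hp : ∀ᵐ x ∂μ, Tendsto (fun n => p n x) atTop (𝓝 x))
    (hpy : Tendsto (fun n => p n y) atTop (𝓝 y)) (hpz : Tendsto (fun n => p n z) atTop (𝓝 z))
    (hyz : ContinuousAt (Function.uncurry κ) (y, z))
    (hγyz : Tendsto (fun n => γ n y z) atTop (𝓝 (κ y z)))
    (hγlim : ∀ᵐ x ∂μ, Tendsto (fun n => γ n y x) atTop (𝓝 (κ y x))) :
    Tendsto (fun n => resolventDefect μ κ (γ n) (p n) y z) atTop (𝓝 0) := by
  have h2 := h.tendsto_integral_mul_resolvent (y := y) (z := z) (γ := fun n x => γ n y x)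
    (ρ := fun n x => kernelResolvent μ κ (p n x) (p n z))
    (fun n => (hγm n).comp measurable_prodMk_left) (fun n x => hγ _ _ _) hγlim
    (fun n => h.measurable_resolvent.comp ((hpm n).prodMk measurable_const))
    (fun n x => h.abs_resolvent_le _ _)
    (by
      filter_upwards [hcont z, hp] with x hx hpx
      exact h.tendsto_resolvent hpx hpz hx hcont)
  have h3 := (hγyz.add (h.tendsto_resolvent hpy hpz hyz hcont)).add h2
  rwa [show κ y z + kernelResolvent μ κ y z + (-κ y z - kernelResolvent μ κ y z) = 0 by ring] at h3

lemma tendsto_integral_resolventDefect_sq {γ : ℕ → X → X → ℝ} {p : ℕ → X → X}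
    (hγm : ∀ n, Measurable (Function.uncurry (γ n))) (hγ : ∀ n x y, |γ n x y| ≤ c)
    (hpm : ∀ n, Measurable (p n))
    (hcont : ∀ z, ∀ᵐ w ∂μ, ContinuousAt (Function.uncurry κ) (w, z))
    (hp : ∀ᵐ x ∂μ, Tendsto (fun n => p n x) atTop (𝓝 x))
    (hγlim : ∀ᵐ y ∂μ, ∀ᵐ x ∂μ, Tendsto (fun n => γ n y x) atTop (𝓝 (κ y x))) :
    Tendsto (fun n => ∫ y, ∫ z, resolventDefect μ κ (γ n) (p n) y z ^ 2 ∂μ ∂μ) atTop (𝓝 0) := by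
  have hmeas : ∀ n, Measurable (Function.uncurry fun y z =>
      resolventDefect μ κ (γ n) (p n) y z ^ 2) := by
    intro n
    have h1 : Measurable (Function.uncurry fun y z => kernelResolvent μ κ (p n y) (p n z)) :=
      h.measurable_resolvent.comp
        (((hpm n).comp measurable_fst).prodMk ((hpm n).comp measurable_snd))
    exact (((hγm n).add h1).add (measurable_integral_mul (hγm n) h1)).pow_const 2
  -- A common bound for the three terms of the defect, needed for dominated convergence in each
  -- variable.
  set E : ℝ := c + D * (1 - q)⁻¹ + c * (D * (1 - q)⁻¹) * μ.real Set.univ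
  have hbd : ∀ n y z, ‖resolventDefect μ κ (γ n) (p n) y z ^ 2‖ ≤ E ^ 2 := by
    intro n y z
    rw [norm_pow]
    refine pow_le_pow_left₀ (norm_nonneg _) ?_ 2
    refine (norm_add_le _ _).trans (add_le_add ((norm_add_le _ _).trans
      (add_le_add (hγ _ _ _) (h.abs_resolvent_le _ _))) ?_)
    exact abs_integral_mul_le (fun x => hγ n y x) fun x => h.abs_resolvent_le _ _
  have hinner : ∀ᵐ y ∂μ, Tendsto (fun n => ∫ z, resolventDefect μ κ (γ n) (p n) y z ^ 2 ∂μ)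
      atTop (𝓝 0) := by
    filter_upwards [hp, hγlim] with y hpy hy
    have := tendsto_integral_of_dominated_convergence (μ := μ)
      (F := fun n z => resolventDefect μ κ (γ n) (p n) y z ^ 2) (f := fun _ => 0)
      (fun _ => E ^ 2) (fun n => ((hmeas n).comp measurable_prodMk_left).aestronglyMeasurable)
      (integrable_const _) (fun n => .of_forall fun z => hbd n y z) (by
        filter_upwards [hp, hy, hcont y] with z hpz hyz hc
        simpa using (h.tendsto_resolventDefect hγm hγ hpm hcont hp hpy hpz
          (h.continuousAt_swap hc) hyz hy).pow 2)
    simpa using this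
  have := tendsto_integral_of_dominated_convergence (μ := μ)
    (F := fun n y => ∫ z, resolventDefect μ κ (γ n) (p n) y z ^ 2 ∂μ) (f := fun _ => 0)
    (fun _ => E ^ 2 * μ.real Set.univ)
    (fun n => (hmeas n).stronglyMeasurable.integral_prod_right.aestronglyMeasurable)
    (integrable_const _)
    (fun n => .of_forall fun y => norm_integral_le_of_norm_le_const (.of_forall (hbd n y))) hinner
  simpa using this

end GeometricKernel

end Resolvent

/-! ### Square grids, functions constant on cells, and cell means. -/

section Grid

/-- The index of the cell of the grid of mesh `δ` through `a` that contains `y`. -/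
noncomputable def gridIndex (δ : ℝ) (a y : Plane) : ℤ × ℤ :=
  (⌊(y 0 - a 0) / δ + 1 / 2⌋, ⌊(y 1 - a 1) / δ + 1 / 2⌋)

lemma floor_half_add_div_eq_iff {δ : ℝ} (hδ : 0 < δ) (s t : ℝ) (i : ℤ) :
    ⌊(s - t) / δ + 1 / 2⌋ = i ↔ s - (t + δ * i) ∈ Set.Ico (-(δ / 2)) (δ / 2) := by
  rw [Int.floor_eq_iff, Set.mem_Ico]
  have e : (s - t) / δ + 1 / 2 = (s - t + δ / 2) / δ := by field_simp
  rw [e, le_div_iff₀ hδ, div_lt_iff₀ hδ]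
  constructor <;> rintro ⟨h1, h2⟩ <;> constructor <;> nlinarith

lemma mem_gridCell_gridNode {δ : ℝ} (hδ : 0 < δ) (a y : Plane) (i : ℤ × ℤ) :
    y ∈ gridCell δ (gridNode δ a i) ↔ gridIndex δ a y = i := by
  rw [gridIndex, Prod.ext_iff, floor_half_add_div_eq_iff hδ, floor_half_add_div_eq_iff hδ]
  simp [gridCell, gridNode, Fin.forall_fin_two]

lemma measurable_plane_coord (j : Fin 2) : Measurable fun y : Plane => y j :=
  (EuclideanSpace.proj (𝕜 := ℝ) j).continuous.measurable

lemma measurable_gridIndex (δ : ℝ) (a : Plane) : Measurable (gridIndex δ a) :=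
  (Int.measurable_floor.comp ((((measurable_plane_coord 0).sub_const _).div_const _).add_const
    _)).prodMk
  (Int.measurable_floor.comp ((((measurable_plane_coord 1).sub_const _).div_const _).add_const _))

lemma measurableSet_gridCell (δ : ℝ) (x : Plane) : MeasurableSet (gridCell δ x) := by
  rw [gridCell, Set.ofPred_forall]
  exact .iInter fun j => ((measurable_plane_coord j).sub_const _) measurableSet_Ico

lemma norm_sub_le_of_mem_gridCell {δ : ℝ} {x y : Plane} (hy : y ∈ gridCell δ x) :
    ‖y - x‖ ≤ δ := by
  have h0 := hy 0
  have h1 := hy 1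
  rw [Set.mem_Ico] at h0 h1
  have hδ : 0 ≤ δ := by linarith
  rw [EuclideanSpace.norm_eq]
  refine Real.sqrt_le_iff.2 ⟨hδ, ?_⟩
  simp only [Fin.sum_univ_two, PiLp.sub_apply, Real.norm_eq_abs, sq_abs]
  nlinarith

lemma isBounded_gridCell (δ : ℝ) (x : Plane) : Bornology.IsBounded (gridCell δ x) :=
  (Metric.isBounded_closedBall (x := x) (r := δ)).subset fun y hy => by
    rw [Metric.mem_closedBall, dist_eq_norm]; exact norm_sub_le_of_mem_gridCell hy

lemma volume_gridCell {δ : ℝ} (hδ : 0 < δ) (x : Plane) :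
    volume (gridCell δ x) = ENNReal.ofReal (δ ^ 2) := by
  have h := (EuclideanSpace.volume_preserving_symm_measurableEquiv_toLp (Fin 2)).measure_preimage
    (s := Set.univ.pi fun j => Set.Ico (x j - δ / 2) (x j + δ / 2))
    (MeasurableSet.univ_pi fun j => measurableSet_Ico).nullMeasurableSet
  have e : (MeasurableEquiv.toLp 2 (Fin 2 → ℝ)).symm ⁻¹'
      (Set.univ.pi fun j => Set.Ico (x j - δ / 2) (x j + δ / 2)) = gridCell δ x := by
    ext y
    simp only [Set.mem_preimage, Set.mem_univ_pi, Set.mem_Ico, gridCell, Set.mem_ofPred_eq]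
    refine forall_congr' fun j => ?_
    change _ ≤ y j ∧ y j < _ ↔ _
    constructor <;> rintro ⟨h1, h2⟩ <;> constructor <;> linarith
  rw [← e, h, Real.volume_pi_Ico]
  simp only [Fin.prod_univ_two]
  rw [← ENNReal.ofReal_mul (by linarith)]
  congr 1
  ring

lemma measureReal_gridCell {δ : ℝ} (hδ : 0 < δ) (x : Plane) :
    volume.real (gridCell δ x) = cellArea δ := by
  rw [cellArea, Measure.real, Measure.real, volume_gridCell hδ, volume_gridCell hδ]

lemma cellArea_eq {δ : ℝ} (hδ : 0 < δ) : cellArea δ = δ ^ 2 := by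
  rw [cellArea, Measure.real, volume_gridCell hδ, ENNReal.toReal_ofReal (by positivity)]

lemma cellArea_pos {δ : ℝ} (hδ : 0 < δ) : 0 < cellArea δ := by
  rw [cellArea_eq hδ]; positivity

instance isFiniteMeasure_restrict_gridCell (δ : ℝ) (x : Plane) :
    IsFiniteMeasure (volume.restrict (gridCell δ x)) :=
  ⟨by rw [Measure.restrict_apply_univ]; exact (isBounded_gridCell δ x).measure_lt_top⟩

lemma setIntegral_gridCell_add (δ : ℝ) (x : Plane) (f : Plane → ℝ) :
    ∫ u in gridCell δ 0, f (x + u) = ∫ y in gridCell δ x, f y := by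
  have h := (measurePreserving_add_left (volume : Measure Plane) x).setIntegral_preimage_emb
    (measurableEmbedding_addLeft x) f (gridCell δ x)
  have e : (fun u => x + u) ⁻¹' gridCell δ x = gridCell δ 0 := by
    ext u
    simp only [gridCell, Set.mem_preimage, Set.mem_ofPred_eq, PiLp.add_apply, PiLp.zero_apply,
      add_sub_cancel_left, sub_zero]
  rw [← h, e]

variable {δ : ℝ} {a : Plane} {I : Finset (ℤ × ℤ)}

lemma mem_gridWindow (hδ : 0 < δ) {y : Plane} : y ∈ gridWindow δ a I ↔ gridIndex δ a y ∈ I := by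
  simp [gridWindow, mem_gridCell_gridNode hδ]

lemma measurableSet_gridWindow : MeasurableSet (gridWindow δ a I) :=
  Finset.measurableSet_biUnion I fun _ _ => measurableSet_gridCell _ _

lemma isBounded_gridWindow : Bornology.IsBounded (gridWindow δ a I) :=
  (Bornology.isBounded_biUnion I.finite_toSet).2 fun _ _ => isBounded_gridCell _ _

lemma disjoint_gridCell_gridNode (hδ : 0 < δ) {i j : ℤ × ℤ} (hij : i ≠ j) :
    Disjoint (gridCell δ (gridNode δ a i)) (gridCell δ (gridNode δ a j)) := by
  refine Set.disjoint_left.2 fun y h1 h2 => hij ?_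
  rw [mem_gridCell_gridNode hδ] at h1 h2
  exact h1.symm.trans h2

lemma setIntegral_gridWindow (hδ : 0 < δ) {f : Plane → ℝ}
    (hf : ∀ i ∈ I, IntegrableOn f (gridCell δ (gridNode δ a i))) :
    ∫ y in gridWindow δ a I, f y = ∑ i ∈ I, ∫ y in gridCell δ (gridNode δ a i), f y :=
  integral_biUnion_finset I (fun _ _ => measurableSet_gridCell _ _)
    (fun _ _ _ _ hij => disjoint_gridCell_gridNode hδ hij) hf

lemma setIntegral_gridCell_index (hδ : 0 < δ) (f : ℤ × ℤ → ℝ) (i : ℤ × ℤ) :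
    ∫ y in gridCell δ (gridNode δ a i), f (gridIndex δ a y) = cellArea δ * f i := by
  rw [setIntegral_congr_fun (g := fun _ => f i) (measurableSet_gridCell _ _) fun y hy => by
    simp only [(mem_gridCell_gridNode hδ a y i).1 hy]]
  simp [measureReal_gridCell hδ]

/-- This dictionary between cellwise constant functions and finite sums lets matrix products be
treated as integrals over the window. -/
lemma setIntegral_gridWindow_index (hδ : 0 < δ) (f : ℤ × ℤ → ℝ) :
    ∫ y in gridWindow δ a I, f (gridIndex δ a y) = cellArea δ * ∑ i ∈ I, f i := by
  rw [setIntegral_gridWindow hδ, Finset.mul_sum]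
  · exact Finset.sum_congr rfl fun i _ => setIntegral_gridCell_index hδ f i
  · intro i _
    refine IntegrableOn.congr_fun (f := fun _ => f i) (integrable_const _) (fun y hy => ?_)
      (measurableSet_gridCell _ _)
    simp only [(mem_gridCell_gridNode hδ a y i).1 hy]

lemma measureReal_gridWindow (hδ : 0 < δ) :
    volume.real (gridWindow δ a I) = I.card * cellArea δ := by
  have := setIntegral_gridWindow_index (a := a) (I := I) hδ fun _ => 1
  simpa [mul_comm] using this

lemma mem_gridCell_node_index (hδ : 0 < δ) (y : Plane) :
    y ∈ gridCell δ (gridNode δ a (gridIndex δ a y)) :=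
  (mem_gridCell_gridNode hδ a y _).2 rfl

lemma measurable_comp_gridIndex {β : Type*} [MeasurableSpace β] (f : ℤ × ℤ → β) :
    Measurable fun y => f (gridIndex δ a y) :=
  (measurable_of_countable f).comp (measurable_gridIndex δ a)

/-- The mean of the kernel `κ` over the product of the cells with indices `i` and `j`. -/
noncomputable def cellMean (κ : Plane → Plane → ℝ) (δ : ℝ) (a : Plane) (i j : ℤ × ℤ) : ℝ :=
  (cellArea δ ^ 2)⁻¹ *
    ∫ x in gridCell δ (gridNode δ a i), ∫ y in gridCell δ (gridNode δ a j), κ x y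

lemma abs_cellMean_sub_le (hδ : 0 < δ) {κ : Plane → Plane → ℝ}
    (hm : Measurable (Function.uncurry κ)) {c : ℝ} (hb : ∀ y z, |κ y z| ≤ c) {i j : ℤ × ℤ}
    {t η : ℝ} (ht : ∀ x ∈ gridCell δ (gridNode δ a i), ∀ y ∈ gridCell δ (gridNode δ a j),
      |κ x y - t| ≤ η) :
    |cellMean κ δ a i j - t| ≤ η := by
  have hb0 := cellArea_pos hδ
  have hin : ∀ x ∈ gridCell δ (gridNode δ a i),
      ‖(∫ y in gridCell δ (gridNode δ a j), κ x y) - cellArea δ * t‖ ≤ η * cellArea δ := by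
    intro x hx
    have h1 : IntegrableOn (κ x) (gridCell δ (gridNode δ a j)) :=
      .of_abs_le (hm.comp measurable_prodMk_left) (hb x)
    have h2 : (∫ y in gridCell δ (gridNode δ a j), κ x y) - cellArea δ * t
        = ∫ y in gridCell δ (gridNode δ a j), (κ x y - t) := by
      rw [integral_sub h1 (integrable_const t)]
      simp [measureReal_gridCell hδ]
    rw [h2, ← measureReal_gridCell hδ (gridNode δ a j)]
    exact norm_setIntegral_le_of_norm_le_const (isBounded_gridCell _ _).measure_lt_top (ht x hx)
  have hmeas : Measurable fun x => ∫ y in gridCell δ (gridNode δ a j), κ x y :=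
    hm.stronglyMeasurable.integral_prod_right.measurable
  have hint : IntegrableOn (fun x => ∫ y in gridCell δ (gridNode δ a j), κ x y)
      (gridCell δ (gridNode δ a i)) := by
    refine .of_abs_le (c := c * (volume.restrict (gridCell δ (gridNode δ a j))).real Set.univ)
      hmeas fun x => ?_
    rw [← Real.norm_eq_abs]
    exact norm_integral_le_of_norm_le_const (.of_forall (hb x))
  have hout := norm_setIntegral_le_of_norm_le_const (μ := volume)
    (isBounded_gridCell _ (gridNode δ a i)).measure_lt_top hin
  rw [integral_sub hint (integrable_const _), measureReal_gridCell hδ] at hout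
  simp only [integral_const, MeasurableSet.univ, measureReal_restrict_apply, Set.univ_inter,
    measureReal_gridCell hδ, smul_eq_mul, Real.norm_eq_abs] at hout
  rw [cellMean, show ∀ s : ℝ, (cellArea δ ^ 2)⁻¹ * s - t
    = (cellArea δ ^ 2)⁻¹ * (s - cellArea δ * (cellArea δ * t)) by intro s; field_simp, abs_mul,
    abs_of_pos (by positivity : 0 < (cellArea δ ^ 2)⁻¹), inv_mul_le_iff₀ (by positivity)]
  linarith

lemma abs_cellMean_le (hδ : 0 < δ) {κ : Plane → Plane → ℝ}
    (hm : Measurable (Function.uncurry κ)) {c : ℝ} (hb : ∀ y z, |κ y z| ≤ c) (i j : ℤ × ℤ) :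
    |cellMean κ δ a i j| ≤ c := by
  simpa using abs_cellMean_sub_le (a := a) hδ hm hb (i := i) (j := j) (t := 0) (η := c)
    fun x _ y _ => by simpa using hb x y

lemma tendsto_node_index {δs : ℕ → ℝ} (hδ : ∀ n, 0 < δs n) (hlim : Tendsto δs atTop (𝓝 0))
    (as : ℕ → Plane) (y : Plane) :
    Tendsto (fun n => gridNode (δs n) (as n) (gridIndex (δs n) (as n) y)) atTop (𝓝 y) := by
  rw [tendsto_iff_norm_sub_tendsto_zero]
  refine squeeze_zero (fun _ => norm_nonneg _) (fun n => ?_) hlim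
  rw [norm_sub_rev]
  exact norm_sub_le_of_mem_gridCell (mem_gridCell_node_index (hδ n) y)

lemma tendsto_cellMean_index {δs : ℕ → ℝ} (hδ : ∀ n, 0 < δs n) (hlim : Tendsto δs atTop (𝓝 0))
    (as : ℕ → Plane) {κ : Plane → Plane → ℝ} (hm : Measurable (Function.uncurry κ)) {c : ℝ}
    (hb : ∀ y z, |κ y z| ≤ c) {y z : Plane} (hyz : ContinuousAt (Function.uncurry κ) (y, z)) :
    Tendsto (fun n => cellMean κ (δs n) (as n) (gridIndex (δs n) (as n) y)
      (gridIndex (δs n) (as n) z)) atTop (𝓝 (κ y z)) := by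
  rw [Metric.tendsto_atTop']
  intro ε hε
  obtain ⟨r, hr, hcont⟩ := Metric.continuousAt_iff.1 hyz (ε / 2) (by positivity)
  obtain ⟨N, hN⟩ := eventually_atTop.1 (hlim.eventually (gt_mem_nhds (show 0 < r / 2 by positivity)))
  refine ⟨N, fun n hn => ?_⟩
  have hclose : ∀ {w x : Plane},
      x ∈ gridCell (δs n) (gridNode (δs n) (as n) (gridIndex (δs n) (as n) w)) →
      dist x w < r := by
    intro w x hx
    have h1 := norm_sub_le_of_mem_gridCell hx
    have h2 := norm_sub_le_of_mem_gridCell (mem_gridCell_node_index (a := as n) (hδ n) w)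
    rw [norm_sub_rev] at h2
    have h3 := norm_add_le (x - gridNode (δs n) (as n) (gridIndex (δs n) (as n) w))
      (gridNode (δs n) (as n) (gridIndex (δs n) (as n) w) - w)
    rw [sub_add_sub_cancel] at h3
    rw [dist_eq_norm]
    linarith [hN n hn.le]
  rw [Real.dist_eq]
  refine (abs_cellMean_sub_le (hδ n) hm hb (η := ε / 2) fun u hu v hv => ?_).trans_lt
    (by linarith)
  have := @hcont (u, v) (by rw [Prod.dist_eq]; exact max_lt (hclose hu) (hclose hv))
  rw [Real.dist_eq] at this
  exact this.le

end Grid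

/-! ### The kernel `lam * (g - 1)` and its discretisation on fine grids. -/

section CorrelationKernel

/-- The kernel `lam * (g ‖y - z‖ - 1)`. -/
noncomputable def corrKernel (lam : ℝ) (g : ℝ → ℝ) (y z : Plane) : ℝ := lam * (g ‖y - z‖ - 1)

variable {lam : ℝ} {g : ℝ → ℝ} {S : Set Plane}

lemma measurable_corrKernel (hg : Measurable g) :
    Measurable (Function.uncurry (corrKernel lam g)) := by
  unfold corrKernel Function.uncurry
  exact ((hg.comp (measurable_fst.sub measurable_snd).norm).sub_const 1).const_mul lam

lemma corrKernel_symm (y z : Plane) : corrKernel lam g y z = corrKernel lam g z y := by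
  rw [corrKernel, corrKernel, norm_sub_rev]

lemma exists_abs_sub_one_le (hg0 : ∀ r, 0 ≤ r → 0 ≤ g r) (hgb : ∃ M, ∀ r, 0 ≤ r → g r ≤ M) :
    ∃ M, 1 ≤ M ∧ ∀ r, 0 ≤ r → |g r - 1| ≤ M := by
  obtain ⟨M, hM⟩ := hgb
  have h0 : 0 ≤ M := (hg0 0 le_rfl).trans (hM 0 le_rfl)
  refine ⟨M + 1, by linarith, fun r hr => ?_⟩
  have h1 := hg0 r hr
  have h2 := hM r hr
  rw [abs_le]; constructor <;> linarith

lemma abs_corrKernel_le (hlam : 0 < lam) {M : ℝ} (hM : ∀ r, 0 ≤ r → |g r - 1| ≤ M) (y z : Plane) :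
    |corrKernel lam g y z| ≤ lam * M := by
  rw [corrKernel, abs_mul, abs_of_pos hlam]
  exact mul_le_mul_of_nonneg_left (hM _ (norm_nonneg _)) hlam.le

/-- The kernel depends on the difference of its arguments only, so the exceptional set is a
translate of a null set. -/
lemma ae_continuousAt_corrKernel (hg : ∀ᵐ z : Plane, ContinuousAt (fun w : Plane => g ‖w‖) z)
    (z : Plane) :
    ∀ᵐ w : Plane, ContinuousAt (Function.uncurry (corrKernel lam g)) (w, z) := by
  filter_upwards [(measurePreserving_sub_right volume z).quasiMeasurePreserving.ae hg] with w hw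
  have h1 : ContinuousAt (fun p : Plane × Plane => g ‖p.1 - p.2‖) (w, z) :=
    ContinuousAt.comp (x := (w, z)) (g := fun w : Plane => g ‖w‖)
      (f := fun p : Plane × Plane => p.1 - p.2) hw (by fun_prop)
  exact (h1.sub continuousAt_const).const_mul lam

lemma kernelPow_corrKernel (k : ℕ) (y z : Plane) :
    kernelPow (volume.restrict S) (corrKernel lam g) k y z =
      lam ^ (k + 1) * iterKernel g S k y z := by
  induction k generalizing y z with
  | zero => simp [kernelPow, iterKernel, corrKernel]
  | succ k ih =>
    simp only [kernelPow, iterKernel, ih, corrKernel]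
    rw [← integral_const_mul]
    congr 1; ext x; ring

lemma mul_neumannTerm (y z : Plane) (k : ℕ) :
    lam * neumannTerm lam g S y z k =
      (-1) ^ (k + 1) * kernelPow (volume.restrict S) (corrKernel lam g) k y z := by
  rw [neumannTerm, kernelPow_corrKernel]; ring

lemma mul_neumannMatrix {δ : ℝ} {a : Plane} {I : Finset (ℤ × ℤ)} (i j : I) :
    lam * neumannMatrix lam g δ a I i j =
      kernelResolvent (volume.restrict (gridWindow δ a I)) (corrKernel lam g)
        (gridNode δ a i) (gridNode δ a j) := by
  simp only [neumannMatrix, Matrix.of_apply, kernelResolvent, ← mul_neumannTerm, tsum_mul_left]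

/-- Of the convergence of the series only this is used: its terms on the diagonal tend to zero. -/
lemma exists_geometricKernel (hlam : 0 < lam) (hg : Measurable g) {M : ℝ}
    (hM : ∀ r, 0 ≤ r → |g r - 1| ≤ M) (hS : MeasurableSet S)
    [IsFiniteMeasure (volume.restrict S)]
    (hsum : ∀ y ∈ S, ∀ z ∈ S, Summable (neumannTerm lam g S y z)) :
    ∃ D q, GeometricKernel (volume.restrict S) (corrKernel lam g) (lam * M) D q := by
  have hb := abs_corrKernel_le hlam hM
  obtain ⟨D, q, -, hq0, hq1, h⟩ := exists_kernelPow_geometric (μ := volume.restrict S)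
    (measurable_corrKernel hg) hb corrKernel_symm (by
      filter_upwards [ae_restrict_mem hS] with y hy
      have h1 := ((hsum y hy y hy).mul_left lam).tendsto_atTop_zero.norm
      simp only [mul_neumannTerm, norm_mul, norm_pow, norm_neg, norm_one, one_pow, one_mul,
        norm_zero] at h1
      exact tendsto_zero_iff_norm_tendsto_zero.2 h1)
  exact ⟨D, q, measurable_corrKernel hg, hb, corrKernel_symm, hq0, hq1, h⟩

/-- The defect of the discrete resolvent equation on a grid. -/
noncomputable def gridDefect (κ ρ : Plane → Plane → ℝ) (δ : ℝ) (a : Plane) (I : Finset (ℤ × ℤ))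
    (i j : ℤ × ℤ) : ℝ :=
  cellMean κ δ a i j + ρ (gridNode δ a i) (gridNode δ a j) +
    cellArea δ * ∑ l ∈ I, cellMean κ δ a i l * ρ (gridNode δ a l) (gridNode δ a j)

lemma resolventDefect_gridIndex {κ : Plane → Plane → ℝ} {δ : ℝ} (hδ : 0 < δ) {a : Plane}
    {I : Finset (ℤ × ℤ)} (y z : Plane) :
    resolventDefect (volume.restrict (gridWindow δ a I)) κ
      (fun y z => cellMean κ δ a (gridIndex δ a y) (gridIndex δ a z))
      (fun y => gridNode δ a (gridIndex δ a y)) y z =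
    gridDefect κ (kernelResolvent (volume.restrict (gridWindow δ a I)) κ) δ a I
      (gridIndex δ a y) (gridIndex δ a z) := by
  rw [resolventDefect, gridDefect]
  congr 1
  exact setIntegral_gridWindow_index hδ fun l => cellMean κ δ a (gridIndex δ a y) l *
    kernelResolvent (volume.restrict (gridWindow δ a I)) κ (gridNode δ a l)
      (gridNode δ a (gridIndex δ a z))

/-- With cell means for the kernel and nodes for the points, the defect is constant on products of
cells, so its squared `L²` norm is a squared Frobenius norm. -/
lemma integral_resolventDefect_sq {κ : Plane → Plane → ℝ} {δ : ℝ} (hδ : 0 < δ) {a : Plane}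
    {I : Finset (ℤ × ℤ)} :
    ∫ y in gridWindow δ a I, ∫ z in gridWindow δ a I,
      resolventDefect (volume.restrict (gridWindow δ a I)) κ
        (fun y z => cellMean κ δ a (gridIndex δ a y) (gridIndex δ a z))
        (fun y => gridNode δ a (gridIndex δ a y)) y z ^ 2 =
      cellArea δ ^ 2 * ∑ i ∈ I, ∑ j ∈ I,
        gridDefect κ (kernelResolvent (volume.restrict (gridWindow δ a I)) κ) δ a I i j ^ 2 := by
  simp only [resolventDefect_gridIndex hδ]
  have h1 : ∀ y, ∫ z in gridWindow δ a I,
      gridDefect κ (kernelResolvent (volume.restrict (gridWindow δ a I)) κ) δ a I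
        (gridIndex δ a y) (gridIndex δ a z) ^ 2 = _ := fun y =>
    setIntegral_gridWindow_index hδ fun j =>
      gridDefect κ (kernelResolvent (volume.restrict (gridWindow δ a I)) κ) δ a I
        (gridIndex δ a y) j ^ 2
  simp only [h1]
  rw [setIntegral_gridWindow_index hδ fun i => cellArea δ * ∑ j ∈ I,
    gridDefect κ (kernelResolvent (volume.restrict (gridWindow δ a I)) κ) δ a I i j ^ 2,
    ← Finset.mul_sum]
  ring

lemma measurable_comp_gridIndex₂ (δ : ℝ) (a : Plane) (f : ℤ × ℤ → ℤ × ℤ → ℝ) :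
    Measurable (Function.uncurry fun y z => f (gridIndex δ a y) (gridIndex δ a z)) := by
  have h2 : Measurable (Function.uncurry f) := measurable_of_countable _
  have h1 : Measurable fun p : Plane × Plane => (gridIndex δ a p.1, gridIndex δ a p.2) :=
    ((measurable_gridIndex δ a).comp measurable_fst).prodMk
        ((measurable_gridIndex δ a).comp measurable_snd)
  exact h2.comp h1

/-- Uniformity over all grids comes from contradiction: bad grids with mesh tending to zero and
arbitrary origins would form a sequence violating the `L²` limit. -/
lemma exists_gridDefect_lt {κ : Plane → Plane → ℝ} {c D q : ℝ} [IsFiniteMeasure (volume.restrict S)]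
    (h : GeometricKernel (volume.restrict S) κ c D q)
    (hcont : ∀ z, ∀ᵐ w : Plane, ContinuousAt (Function.uncurry κ) (w, z)) {η : ℝ} (hη : 0 < η) :
    ∃ δ₀ : ℝ, 0 < δ₀ ∧ ∀ (δ : ℝ) (a : Plane) (I : Finset (ℤ × ℤ)), 0 < δ → δ < δ₀ →
      gridWindow δ a I = S →
      cellArea δ ^ 2 * ∑ i ∈ I, ∑ j ∈ I,
        gridDefect κ (kernelResolvent (volume.restrict S) κ) δ a I i j ^ 2 < η := by
  by_contra! hcon
  choose δs as Is hpos hlt hS hge using fun n : ℕ =>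
    hcon (1 / ((n : ℝ) + 1)) Nat.one_div_pos_of_nat
  have hlim : Tendsto δs atTop (𝓝 0) :=
    squeeze_zero (fun n => (hpos n).le) (fun n => (hlt n).le) tendsto_one_div_add_atTop_nhds_zero_nat
  have hcont' : ∀ z, ∀ᵐ w ∂volume.restrict S, ContinuousAt (Function.uncurry κ) (w, z) :=
    fun z => ae_restrict_of_ae (hcont z)
  have key := h.tendsto_integral_resolventDefect_sq
    (γ := fun n y z => cellMean κ (δs n) (as n) (gridIndex (δs n) (as n) y)
      (gridIndex (δs n) (as n) z))
    (p := fun n y => gridNode (δs n) (as n) (gridIndex (δs n) (as n) y))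
    (fun n => measurable_comp_gridIndex₂ _ _ _)
    (fun n x y => abs_cellMean_le (hpos n) h.measurable h.bound _ _)
    (fun n => measurable_comp_gridIndex _) hcont'
    (.of_forall fun x => tendsto_node_index hpos hlim as x)
    (.of_forall fun y => by
      filter_upwards [hcont' y] with x hx
      exact tendsto_cellMean_index hpos hlim as h.measurable h.bound (h.continuousAt_swap hx))
  refine absurd (ge_of_tendsto' key fun n => ?_) (not_le.2 hη)
  have := integral_resolventDefect_sq (κ := κ) (hpos n) (a := as n) (I := Is n)
  rw [hS n] at this
  rw [this]
  exact hge n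

end CorrelationKernel

/-! ### Covariances of counts from the intensity and the pair correlation function. -/

section Covariance

/-- Separating the diagonal turns the factorial second moment into the ordinary one and produces the
term in `A ∩ D` of the covariance. -/
lemma ncard_mul_ncard {α : Type*} {X Y : Set α} (hX : X.Finite) (hY : Y.Finite) :
    X.ncard * Y.ncard =
      {p : α × α | p.1 ∈ X ∧ p.2 ∈ Y ∧ p.1 ≠ p.2}.ncard + (X ∩ Y).ncard := by
  have hXY : (X ×ˢ Y).Finite := hX.prod hY
  have h1 : ((fun x : α => (x, x)) '' (X ∩ Y)).ncard = (X ∩ Y).ncard :=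
    Set.ncard_image_of_injective _ fun x y h => congrArg Prod.fst h
  have h2 : X ×ˢ Y = {p : α × α | p.1 ∈ X ∧ p.2 ∈ Y ∧ p.1 ≠ p.2} ∪
      (fun x : α => (x, x)) '' (X ∩ Y) := by
    ext ⟨x, y⟩
    simp only [Set.mem_prod, Set.mem_union, Set.mem_ofPred_eq, Set.mem_image, Set.mem_inter_iff,
      Prod.mk.injEq]
    by_cases h : x = y
    · subst h; simp
    · constructor
      · rintro ⟨hx, hy⟩; exact .inl ⟨hx, hy, h⟩
      · rintro (⟨hx, hy, -⟩ | ⟨w, -, rfl, rfl⟩)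
        · exact ⟨hx, hy⟩
        · exact absurd rfl h
  rw [← Set.ncard_prod, ← h1, h2, Set.ncard_union_eq ?_ (hXY.subset (h2 ▸ Set.subset_union_left))
    (hXY.subset (h2 ▸ Set.subset_union_right))]
  · refine Set.disjoint_left.2 ?_
    rintro ⟨x, y⟩ ⟨-, -, h⟩ ⟨w, -, hw⟩
    simp only [Prod.mk.injEq] at hw
    exact h (hw.1.symm.trans hw.2)

lemma Bornology.IsBounded.isFiniteMeasure_restrict {A : Set Plane} (hA : Bornology.IsBounded A) :
    IsFiniteMeasure (volume.restrict A) :=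
  ⟨by rw [Measure.restrict_apply_univ]; exact hA.measure_lt_top⟩

lemma lintegral_lintegral_ofReal {κ : Plane → Plane → ℝ} (hm : Measurable (Function.uncurry κ))
    (h0 : ∀ x y, 0 ≤ κ x y) {c : ℝ} (hb : ∀ x y, |κ x y| ≤ c) {A D : Set Plane}
    (hA : Bornology.IsBounded A) (hD : Bornology.IsBounded D) :
    ∫⁻ x in A, ∫⁻ y in D, ENNReal.ofReal (κ x y) = ENNReal.ofReal (∫ x in A, ∫ y in D, κ x y) := by
  have := hA.isFiniteMeasure_restrict
  have := hD.isFiniteMeasure_restrict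
  have hmeas : Measurable fun x => ∫ y in D, κ x y :=
    hm.stronglyMeasurable.integral_prod_right.measurable
  rw [ofReal_integral_eq_lintegral_ofReal]
  · refine lintegral_congr fun x => ?_
    rw [ofReal_integral_eq_lintegral_ofReal]
    · exact .of_abs_le (hm.comp measurable_prodMk_left) (hb x)
    · exact .of_forall (h0 x)
  · refine .of_abs_le (c := c * (volume.restrict D).real Set.univ) hmeas fun x => ?_
    rw [← Real.norm_eq_abs]
    exact norm_integral_le_of_norm_le_const (.of_forall (hb x))
  · exact .of_forall fun x => integral_nonneg (h0 x)

lemma setIntegral_corrKernel {lam : ℝ} {g : ℝ → ℝ} (hg : Measurable g) {M : ℝ}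
    (hM : ∀ r, 0 ≤ r → |g r - 1| ≤ M) {A D : Set Plane} (hA : Bornology.IsBounded A)
    (hD : Bornology.IsBounded D) :
    ∫ x in A, ∫ y in D, corrKernel lam g x y =
      lam * ((∫ x in A, ∫ y in D, g ‖x - y‖) - volume.real A * volume.real D) := by
  have := hA.isFiniteMeasure_restrict
  have := hD.isFiniteMeasure_restrict
  have hm : Measurable (Function.uncurry fun x y : Plane => g ‖x - y‖) :=
    hg.comp (measurable_fst.sub measurable_snd).norm
  have hb : ∀ x y : Plane, |g ‖x - y‖| ≤ M + 1 := fun x y => by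
    have := abs_le.1 (hM _ (norm_nonneg (x - y)))
    rw [abs_le]; constructor <;> linarith
  have hmeas : Measurable fun x => ∫ y in D, g ‖x - y‖ :=
    hm.stronglyMeasurable.integral_prod_right.measurable
  simp only [corrKernel, integral_const_mul]
  congr 1
  have h1 : ∀ x, ∫ y in D, (g ‖x - y‖ - 1) = (∫ y in D, g ‖x - y‖) - volume.real D := fun x => by
    have hmx : Measurable fun y : Plane => g ‖x - y‖ :=
      hg.comp (measurable_const.sub measurable_id).norm
    have h2 : Integrable (fun y => g ‖x - y‖) (volume.restrict D) := .of_abs_le hmx (hb x)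
    rw [integral_sub h2 (integrable_const _)]
    simp
  simp only [h1]
  rw [integral_sub _ (integrable_const _)]
  · simp
  · refine .of_abs_le (c := (M + 1) * (volume.restrict D).real Set.univ) hmeas fun x => ?_
    rw [← Real.norm_eq_abs]
    exact norm_integral_le_of_norm_le_const (.of_forall (hb x))

namespace PlanarPointProcess

variable {Ω : Type*} [MeasurableSpace Ω] {P : Measure Ω} [IsProbabilityMeasure P]
  {Φ : PlanarPointProcess Ω} {lam : ℝ} {g : ℝ → ℝ}

lemma count_nonneg {A : Set Plane} (ω : Ω) : 0 ≤ Φ.count A ω := Nat.cast_nonneg _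

lemma measurable_count_real {A : Set Plane} (hA : Bornology.IsBounded A) (hAm : MeasurableSet A) :
    Measurable (Φ.count A) :=
  (measurable_of_countable fun n : ℕ => (n : ℝ)).comp (Φ.measurable_count A hA hAm)

lemma integral_count (hlam : 0 < lam) (hΦ : Φ.HasIntensity P lam) {A : Set Plane}
    (hA : Bornology.IsBounded A) (hAm : MeasurableSet A) :
    ∫ ω, Φ.count A ω ∂P = lam * volume.real A := by
  rw [integral_eq_lintegral_of_nonneg_ae (.of_forall count_nonneg)
    (measurable_count_real hA hAm).aestronglyMeasurable]
  simp only [count, ENNReal.ofReal_natCast]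
  rw [hΦ A hA hAm, ENNReal.toReal_mul, ENNReal.toReal_ofReal hlam.le, Measure.real]

lemma lintegral_count_mul (hlam : 0 < lam) (hg : Measurable g) (hg0 : ∀ r, 0 ≤ r → 0 ≤ g r) {M : ℝ}
    (hM : ∀ r, 0 ≤ r → |g r - 1| ≤ M)
    (hΦ : Φ.HasIntensity P lam) (hΦ2 : Φ.HasPairCorrelation P lam g) {A D : Set Plane}
    (hA : Bornology.IsBounded A) (hAm : MeasurableSet A)
    (hD : Bornology.IsBounded D) (hDm : MeasurableSet D) :
    ∫⁻ ω, ENNReal.ofReal (Φ.count A ω * Φ.count D ω) ∂P =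
      ENNReal.ofReal (lam ^ 2 * (∫ x in A, ∫ y in D, g ‖x - y‖) + lam * volume.real (A ∩ D)) := by
  have hADb : Bornology.IsBounded (A ∩ D) := hA.subset Set.inter_subset_left
  have h1 : ∀ ω, ENNReal.ofReal (Φ.count A ω * Φ.count D ω) =
      (({p : Plane × Plane | p.1 ∈ Φ.pts ω ∩ A ∧ p.2 ∈ Φ.pts ω ∩ D ∧ p.1 ≠ p.2}.ncard : ℕ) :
        ENNReal) + ((Φ.pts ω ∩ (A ∩ D)).ncard : ENNReal) := by
    intro ω
    rw [count, count, ← Nat.cast_mul, ENNReal.ofReal_natCast,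
      ncard_mul_ncard (Φ.finite_inter ω A hA) (Φ.finite_inter ω D hD), ← Set.inter_inter_distrib_left,
      Nat.cast_add]
  have hmeas : Measurable fun ω => ((Φ.pts ω ∩ (A ∩ D)).ncard : ENNReal) :=
    (measurable_of_countable fun n : ℕ => (n : ENNReal)).comp
      (Φ.measurable_count _ hADb (hAm.inter hDm))
  have hm : Measurable (Function.uncurry fun x y : Plane => g ‖x - y‖) :=
    hg.comp (measurable_fst.sub measurable_snd).norm
  have hb : ∀ x y : Plane, |g ‖x - y‖| ≤ M + 1 := fun x y => by
    have := abs_le.1 (hM _ (norm_nonneg (x - y)))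
    rw [abs_le]; constructor <;> linarith
  have h0 : ∀ x y : Plane, 0 ≤ g ‖x - y‖ := fun x y => hg0 _ (norm_nonneg _)
  have hint : 0 ≤ ∫ x in A, ∫ y in D, g ‖x - y‖ :=
    integral_nonneg fun x => integral_nonneg (h0 x)
  simp only [h1]
  rw [lintegral_add_right _ hmeas, hΦ2 A D hA hAm hD hDm, hΦ _ hADb (hAm.inter hDm),
    lintegral_lintegral_ofReal hm h0 hb hA hD, ENNReal.ofReal_add (by positivity)
      (mul_nonneg hlam.le measureReal_nonneg), ENNReal.ofReal_mul (by positivity),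
    ENNReal.ofReal_mul hlam.le, ofReal_measureReal hADb.measure_lt_top.ne]

lemma memLp_count (hlam : 0 < lam) (hg : Measurable g) (hg0 : ∀ r, 0 ≤ r → 0 ≤ g r) {M : ℝ}
    (hM : ∀ r, 0 ≤ r → |g r - 1| ≤ M)
    (hΦ : Φ.HasIntensity P lam) (hΦ2 : Φ.HasPairCorrelation P lam g) {A : Set Plane}
    (hA : Bornology.IsBounded A) (hAm : MeasurableSet A) : MemLp (Φ.count A) 2 P := by
  have hmeas := (measurable_count_real (Φ := Φ) hA hAm)
  rw [memLp_two_iff_integrable_sq hmeas.aestronglyMeasurable]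
  refine ⟨(hmeas.pow_const 2).aestronglyMeasurable, ?_⟩
  rw [hasFiniteIntegral_iff_ofReal (.of_forall fun ω => sq_nonneg _)]
  simp only [sq]
  rw [lintegral_count_mul hlam hg hg0 hM hΦ hΦ2 hA hAm hA hAm]
  exact ENNReal.ofReal_lt_top

/-- The covariance of the numbers of points in two bounded sets. -/
lemma covariance_count (hlam : 0 < lam) (hg : Measurable g) (hg0 : ∀ r, 0 ≤ r → 0 ≤ g r) {M : ℝ}
    (hM : ∀ r, 0 ≤ r → |g r - 1| ≤ M)
    (hΦ : Φ.HasIntensity P lam) (hΦ2 : Φ.HasPairCorrelation P lam g) {A D : Set Plane}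
    (hA : Bornology.IsBounded A) (hAm : MeasurableSet A)
    (hD : Bornology.IsBounded D) (hDm : MeasurableSet D) :
    covariance (Φ.count A) (Φ.count D) P =
      lam * volume.real (A ∩ D) + lam * ∫ x in A, ∫ y in D, corrKernel lam g x y := by
  rw [covariance_eq_sub (memLp_count hlam hg hg0 hM hΦ hΦ2 hA hAm)
    (memLp_count hlam hg hg0 hM hΦ hΦ2 hD hDm), integral_count hlam hΦ hA hAm,
    integral_count hlam hΦ hD hDm, setIntegral_corrKernel hg hM hA hD]
  simp only [Pi.mul_apply]
  rw [integral_eq_lintegral_of_nonneg_ae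
      (.of_forall fun ω => mul_nonneg (count_nonneg ω) (count_nonneg ω))
      ((measurable_count_real hA hAm).mul (measurable_count_real hD hDm)).aestronglyMeasurable,
    lintegral_count_mul hlam hg hg0 hM hΦ hΦ2 hA hAm hD hDm, ENNReal.toReal_ofReal]
  · ring
  · exact add_nonneg (mul_nonneg (by positivity)
      (integral_nonneg fun x => integral_nonneg fun y => hg0 _ (norm_nonneg _)))
      (mul_nonneg hlam.le measureReal_nonneg)

variable {δ : ℝ} {a : Plane} {I : Finset (ℤ × ℤ)}

lemma covMatrix_eq (hlam : 0 < lam) (hg : Measurable g) (hg0 : ∀ r, 0 ≤ r → 0 ≤ g r) {M : ℝ}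
    (hM : ∀ r, 0 ≤ r → |g r - 1| ≤ M)
    (hΦ : Φ.HasIntensity P lam) (hΦ2 : Φ.HasPairCorrelation P lam g) (hδ : 0 < δ) :
    covMatrix Φ P δ a I = (lam * cellArea δ) •
      (1 + Matrix.of fun i j : I => cellArea δ * cellMean (corrKernel lam g) δ a i j) := by
  have hb := (cellArea_pos hδ).ne'
  ext i j
  rw [covMatrix, Matrix.of_apply, covariance_count hlam hg hg0 hM hΦ hΦ2 (isBounded_gridCell _ _)
    (measurableSet_gridCell _ _) (isBounded_gridCell _ _) (measurableSet_gridCell _ _)]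
  simp only [Matrix.smul_apply, Matrix.add_apply, Matrix.of_apply, cellMean, smul_eq_mul]
  by_cases hij : i = j
  · subst hij
    rw [Set.inter_self, measureReal_gridCell hδ, Matrix.one_apply_eq]
    field_simp
  · rw [(disjoint_gridCell_gridNode hδ fun h => hij (Subtype.ext h)).inter_eq, measureReal_empty,
      Matrix.one_apply_ne hij]
    field_simp
    ring

lemma setIntegral_corrKernel_pairVector (hg : Measurable g) {M : ℝ}
    (hM : ∀ r, 0 ≤ r → |g r - 1| ≤ M) (hδ : 0 < δ) (xo : Plane) (i : I) :
    ∫ x in gridCell δ (gridNode δ a i), ∫ y in gridCell δ xo, corrKernel lam g x y =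
      lam * cellArea δ ^ 2 * pairVector g δ a I xo i := by
  have hb := (cellArea_pos hδ).ne'
  rw [setIntegral_corrKernel hg hM (isBounded_gridCell _ _) (isBounded_gridCell _ _),
    measureReal_gridCell hδ, measureReal_gridCell hδ, pairVector,
    ← setIntegral_gridCell_add δ (gridNode δ a i)]
  have h1 : ∀ u, ∫ v in gridCell δ 0, g ‖gridNode δ a i - xo + u - v‖ =
      ∫ y in gridCell δ xo, g ‖gridNode δ a i + u - y‖ := by
    intro u
    rw [← setIntegral_gridCell_add δ xo]
    congr 1; ext v; congr 2; abel
  simp only [h1]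
  field_simp

lemma covVector_eq (hlam : 0 < lam) (hg : Measurable g) (hg0 : ∀ r, 0 ≤ r → 0 ≤ g r) {M : ℝ}
    (hM : ∀ r, 0 ≤ r → |g r - 1| ≤ M)
    (hΦ : Φ.HasIntensity P lam) (hΦ2 : Φ.HasPairCorrelation P lam g) (hδ : 0 < δ) {xo : Plane}
    (hxo : Disjoint (gridCell δ xo) (gridWindow δ a I)) :
    covVector Φ P δ a I xo = (lam ^ 2 * cellArea δ ^ 2) • pairVector g δ a I xo := by
  ext i
  have hdis : gridCell δ (gridNode δ a i) ∩ gridCell δ xo = ∅ := by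
    refine ((hxo.mono_right ?_).symm).inter_eq
    exact Set.subset_biUnion_of_mem (u := fun i => gridCell δ (gridNode δ a i)) i.2
  rw [covVector, covariance_count hlam hg hg0 hM hΦ hΦ2 (isBounded_gridCell _ _)
    (measurableSet_gridCell _ _) (isBounded_gridCell _ _) (measurableSet_gridCell _ _), hdis,
    setIntegral_corrKernel_pairVector hg hM hδ]
  simp only [measureReal_empty, Pi.smul_apply, smul_eq_mul]
  ring

/-- The entries are means of `g - 1`, seen by taking `lam = 1` in
`setIntegral_corrKernel_pairVector`. -/
lemma abs_pairVector_le (hg : Measurable g) {M : ℝ}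
    (hM : ∀ r, 0 ≤ r → |g r - 1| ≤ M) (hδ : 0 < δ) (xo : Plane) (i : I) :
    |pairVector g δ a I xo i| ≤ M := by
  have hb := cellArea_pos hδ
  have h := setIntegral_corrKernel_pairVector (lam := 1) hg hM hδ (a := a) xo i
  have hin : ∀ x, ‖∫ y in gridCell δ xo, corrKernel 1 g x y‖ ≤ 1 * M * cellArea δ := fun x => by
    rw [← measureReal_gridCell hδ xo]
    exact norm_setIntegral_le_of_norm_le_const (isBounded_gridCell _ _).measure_lt_top
      fun y _ => abs_corrKernel_le one_pos hM x y
  have hout := norm_setIntegral_le_of_norm_le_const (μ := volume)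
    (isBounded_gridCell δ (gridNode δ a i)).measure_lt_top fun x _ => hin x
  rw [h, measureReal_gridCell hδ, Real.norm_eq_abs, abs_mul, abs_of_pos (by positivity)] at hout
  have : 0 < cellArea δ ^ 2 := by positivity
  nlinarith

end PlanarPointProcess

end Covariance

/-! ### Approximate inverses of symmetric matrices, with bounds independent of their size. -/

section MatrixResolvent

open Matrix

variable {ι : Type*} [Fintype ι]

lemma dotProduct_self_nonneg_real (v : ι → ℝ) : 0 ≤ v ⬝ᵥ v :=
  Finset.sum_nonneg fun i _ => mul_self_nonneg (v i)

lemma abs_dotProduct_le (u v : ι → ℝ) : |u ⬝ᵥ v| ≤ √(u ⬝ᵥ u) * √(v ⬝ᵥ v) := by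
  rw [← Real.sqrt_mul (dotProduct_self_nonneg_real u)]
  refine Real.abs_le_sqrt ?_
  simpa [dotProduct, sq] using Finset.sum_mul_sq_le_sq_mul_sq Finset.univ u v

lemma sqrt_dotProduct_self_le {v : ι → ℝ} {M : ℝ} (hM : 0 ≤ M) (hv : ∀ i, |v i| ≤ M) :
    √(v ⬝ᵥ v) ≤ M * √(Fintype.card ι) := by
  rw [show M * √(Fintype.card ι) = √(M ^ 2 * Fintype.card ι) by
    rw [Real.sqrt_mul (sq_nonneg M), Real.sqrt_sq hM]]
  refine Real.sqrt_le_sqrt ?_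
  calc v ⬝ᵥ v ≤ ∑ _i : ι, M ^ 2 := Finset.sum_le_sum fun i _ => by
        rw [← sq, ← sq_abs]; exact pow_le_pow_left₀ (abs_nonneg _) (hv i) 2
    _ = M ^ 2 * Fintype.card ι := by simp [mul_comm]

lemma abs_dotProduct_mulVec_le {N : Matrix ι ι ℝ} {ρ : ℝ} (hρ : 0 ≤ ρ)
    (hN : ∑ i, ∑ j, N i j ^ 2 ≤ ρ ^ 2) (u v : ι → ℝ) :
    |u ⬝ᵥ N *ᵥ v| ≤ ρ * (√(u ⬝ᵥ u) * √(v ⬝ᵥ v)) := by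
  have h1 : (N *ᵥ v) ⬝ᵥ (N *ᵥ v) ≤ ρ ^ 2 * (v ⬝ᵥ v) := by
    calc (N *ᵥ v) ⬝ᵥ (N *ᵥ v) = ∑ i, (∑ j, N i j * v j) ^ 2 := by
          simp [dotProduct, mulVec, sq]
      _ ≤ ∑ i, (∑ j, N i j ^ 2) * (∑ j, v j ^ 2) :=
          Finset.sum_le_sum fun i _ => Finset.sum_mul_sq_le_sq_mul_sq _ _ _
      _ = (∑ i, ∑ j, N i j ^ 2) * (v ⬝ᵥ v) := by rw [Finset.sum_mul]; simp [dotProduct, sq]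
      _ ≤ _ := mul_le_mul_of_nonneg_right hN (dotProduct_self_nonneg_real v)
  have h2 : √((N *ᵥ v) ⬝ᵥ (N *ᵥ v)) ≤ ρ * √(v ⬝ᵥ v) := by
    refine (Real.sqrt_le_sqrt h1).trans_eq ?_
    rw [Real.sqrt_mul (sq_nonneg ρ), Real.sqrt_sq hρ]
  calc |u ⬝ᵥ N *ᵥ v| ≤ √(u ⬝ᵥ u) * √((N *ᵥ v) ⬝ᵥ (N *ᵥ v)) := abs_dotProduct_le _ _
    _ ≤ √(u ⬝ᵥ u) * (ρ * √(v ⬝ᵥ v)) := mul_le_mul_of_nonneg_left h2 (Real.sqrt_nonneg _)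
    _ = _ := by ring

lemma dotProduct_mulVec_comm_of_symm {C : Matrix ι ι ℝ} (hC : Cᵀ = C) (x y : ι → ℝ) :
    (C *ᵥ x) ⬝ᵥ y = x ⬝ᵥ C *ᵥ y := by
  rw [dotProduct_mulVec, ← mulVec_transpose, hC]

/-- The Cauchy-Schwarz inequality for a positive semidefinite matrix. -/
lemma sq_dotProduct_mulVec_le {C : Matrix ι ι ℝ} (hC : Cᵀ = C)
    (hpos : ∀ x : ι → ℝ, 0 ≤ x ⬝ᵥ C *ᵥ x) (x y : ι → ℝ) :
    (x ⬝ᵥ C *ᵥ y) ^ 2 ≤ (x ⬝ᵥ C *ᵥ x) * (y ⬝ᵥ C *ᵥ y) := by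
  have h := discrim_le_zero (a := x ⬝ᵥ C *ᵥ x) (b := 2 * (x ⬝ᵥ C *ᵥ y))
    (c := y ⬝ᵥ C *ᵥ y) fun t => by
      have h0 := hpos (t • x + y)
      have h1 : y ⬝ᵥ C *ᵥ x = x ⬝ᵥ C *ᵥ y := by
        rw [dotProduct_comm, dotProduct_mulVec_comm_of_symm hC]
      simp only [mulVec_add, mulVec_smul, dotProduct_add, add_dotProduct, smul_dotProduct,
        dotProduct_smul, smul_eq_mul, h1] at h0
      linarith
  rw [discrim] at h
  linarith

variable [DecidableEq ι] {A L N : Matrix ι ι ℝ} {ρ l : ℝ}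

/-- With `v = (1 + A) x` one has `x·(1 + N)x = v·(1 + L)x`. The left side is at least half of `x·x`,
the right side at most `1 + l` times the product of the norms of `v` and `x`. -/
lemma sqrt_dotProduct_self_le_of_mul (hA : Aᵀ = A) (hmul : (1 + A) * (1 + L) = 1 + N)
    (hl : 0 ≤ l) (hL : ∑ i, ∑ j, L i j ^ 2 ≤ l ^ 2) (hρ : 0 ≤ ρ) (hρ2 : ρ ≤ 1 / 2)
    (hN : ∑ i, ∑ j, N i j ^ 2 ≤ ρ ^ 2) (x : ι → ℝ) :
    √(x ⬝ᵥ x) ≤ 2 * (1 + l) * √(((1 + A) *ᵥ x) ⬝ᵥ ((1 + A) *ᵥ x)) := by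
  set v := (1 + A) *ᵥ x with hv
  have hA1 : (1 + A)ᵀ = 1 + A := by rw [transpose_add, hA, transpose_one]
  have h1 : x ⬝ᵥ x + x ⬝ᵥ N *ᵥ x = v ⬝ᵥ x + v ⬝ᵥ L *ᵥ x := by
    have : x ⬝ᵥ (1 + N) *ᵥ x = v ⬝ᵥ (1 + L) *ᵥ x := by
      rw [← hmul, ← mulVec_mulVec, hv, dotProduct_mulVec_comm_of_symm hA1]
    simpa [add_mulVec, dotProduct_add] using this
  have h2 := abs_le.1 (abs_dotProduct_mulVec_le hρ hN x x)
  have h3 := (abs_le.1 (abs_dotProduct_mulVec_le hl hL v x)).2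
  have h4 := (abs_le.1 (abs_dotProduct_le v x)).2
  have hs : √(x ⬝ᵥ x) * √(x ⬝ᵥ x) = x ⬝ᵥ x := Real.mul_self_sqrt (dotProduct_self_nonneg_real x)
  rcases (Real.sqrt_nonneg (x ⬝ᵥ x)).eq_or_lt with h0 | h0
  · rw [← h0]; positivity
  · refine le_of_mul_le_mul_right ?_ h0
    have h5 : ρ * (√(x ⬝ᵥ x) * √(x ⬝ᵥ x)) ≤ 1 / 2 * (√(x ⬝ᵥ x) * √(x ⬝ᵥ x)) :=
      mul_le_mul_of_nonneg_right hρ2 (by positivity)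
    linarith [h2.1]

lemma isUnit_det_one_add (hA : Aᵀ = A) (hmul : (1 + A) * (1 + L) = 1 + N)
    (hl : 0 ≤ l) (hL : ∑ i, ∑ j, L i j ^ 2 ≤ l ^ 2) (hρ : 0 ≤ ρ) (hρ2 : ρ ≤ 1 / 2)
    (hN : ∑ i, ∑ j, N i j ^ 2 ≤ ρ ^ 2) : IsUnit (1 + A).det := by
  rw [isUnit_iff_ne_zero]
  intro h0
  obtain ⟨x, hx0, hx⟩ := exists_mulVec_eq_zero_iff.2 h0
  have h1 := sqrt_dotProduct_self_le_of_mul hA hmul hl hL hρ hρ2 hN x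
  rw [hx] at h1
  simp only [dotProduct_zero, Real.sqrt_zero, mul_zero] at h1
  have h2 := Real.sqrt_eq_zero'.1 (le_antisymm h1 (Real.sqrt_nonneg _))
  exact hx0 (dotProduct_self_eq_zero.1 (le_antisymm h2 (dotProduct_self_nonneg_real x)))

lemma abs_dotProduct_inv_mulVec_le (hA : Aᵀ = A) (hmul : (1 + A) * (1 + L) = 1 + N)
    (hl : 0 ≤ l) (hL : ∑ i, ∑ j, L i j ^ 2 ≤ l ^ 2) (hρ : 0 ≤ ρ) (hρ2 : ρ ≤ 1 / 2)
    (hN : ∑ i, ∑ j, N i j ^ 2 ≤ ρ ^ 2) (u v : ι → ℝ) :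
    |u ⬝ᵥ (1 + A)⁻¹ *ᵥ v| ≤ 2 * (1 + l) * (√(u ⬝ᵥ u) * √(v ⬝ᵥ v)) := by
  have hu := isUnit_det_one_add hA hmul hl hL hρ hρ2 hN
  have h1 := sqrt_dotProduct_self_le_of_mul hA hmul hl hL hρ hρ2 hN ((1 + A)⁻¹ *ᵥ v)
  rw [mulVec_mulVec, mul_nonsing_inv _ hu, one_mulVec] at h1
  calc _ ≤ _ := abs_dotProduct_le _ _
    _ ≤ √(u ⬝ᵥ u) * (2 * (1 + l) * √(v ⬝ᵥ v)) :=
        mul_le_mul_of_nonneg_left h1 (Real.sqrt_nonneg _)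
    _ = _ := by ring

/-- The difference is exactly `x·Nv` with `x = (1 + A)⁻¹ u`. -/
lemma abs_dotProduct_sub_inv_mulVec_le (hA : Aᵀ = A) (hmul : (1 + A) * (1 + L) = 1 + N)
    (hl : 0 ≤ l) (hL : ∑ i, ∑ j, L i j ^ 2 ≤ l ^ 2) (hρ : 0 ≤ ρ) (hρ2 : ρ ≤ 1 / 2)
    (hN : ∑ i, ∑ j, N i j ^ 2 ≤ ρ ^ 2) (u v : ι → ℝ) :
    |u ⬝ᵥ (1 + L) *ᵥ v - u ⬝ᵥ (1 + A)⁻¹ *ᵥ v| ≤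
      2 * (1 + l) * ρ * (√(u ⬝ᵥ u) * √(v ⬝ᵥ v)) := by
  have hu := isUnit_det_one_add hA hmul hl hL hρ hρ2 hN
  have hA1 : (1 + A)ᵀ = 1 + A := by rw [transpose_add, hA, transpose_one]
  set x := (1 + A)⁻¹ *ᵥ u with hx
  have hxu : (1 + A) *ᵥ x = u := by rw [hx, mulVec_mulVec, mul_nonsing_inv _ hu, one_mulVec]
  have h1 := sqrt_dotProduct_self_le_of_mul hA hmul hl hL hρ hρ2 hN x
  rw [hxu] at h1
  have h2 : u ⬝ᵥ (1 + L) *ᵥ v - u ⬝ᵥ (1 + A)⁻¹ *ᵥ v = x ⬝ᵥ N *ᵥ v := by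
    have e1 : u ⬝ᵥ (1 + L) *ᵥ v = x ⬝ᵥ (1 + N) *ᵥ v := by
      rw [← hmul, ← mulVec_mulVec, ← hxu, dotProduct_mulVec_comm_of_symm hA1]
    have e2 : u ⬝ᵥ (1 + A)⁻¹ *ᵥ v = x ⬝ᵥ v := by
      rw [← hxu, dotProduct_mulVec_comm_of_symm hA1, mulVec_mulVec, mul_nonsing_inv _ hu,
        one_mulVec]
    rw [e1, e2, add_mulVec, one_mulVec, dotProduct_add]
    ring
  rw [h2]
  calc _ ≤ _ := abs_dotProduct_mulVec_le hρ hN x v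
    _ ≤ ρ * ((2 * (1 + l) * √(u ⬝ᵥ u)) * √(v ⬝ᵥ v)) := by gcongr
    _ = _ := by ring

section Inverse

variable {C : Matrix ι ι ℝ} (hC : Cᵀ = C) (hu : IsUnit C.det)
include hC hu

lemma inv_mulVec_dotProduct (u v : ι → ℝ) : (C⁻¹ *ᵥ u) ⬝ᵥ v = u ⬝ᵥ C⁻¹ *ᵥ v :=
  dotProduct_mulVec_comm_of_symm (by rw [transpose_nonsing_inv, hC]) u v

lemma inv_mulVec_dotProduct_mulVec_inv (u v : ι → ℝ) :
    (C⁻¹ *ᵥ u) ⬝ᵥ C *ᵥ (C⁻¹ *ᵥ v) = u ⬝ᵥ C⁻¹ *ᵥ v := by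
  rw [mulVec_mulVec _ C, mul_nonsing_inv _ hu, one_mulVec, inv_mulVec_dotProduct hC hu]

lemma sq_dotProduct_inv_mulVec_le (hpos : ∀ x : ι → ℝ, 0 ≤ x ⬝ᵥ C *ᵥ x) (u v : ι → ℝ) :
    (u ⬝ᵥ C⁻¹ *ᵥ v) ^ 2 ≤ (u ⬝ᵥ C⁻¹ *ᵥ u) * (v ⬝ᵥ C⁻¹ *ᵥ v) := by
  simpa only [inv_mulVec_dotProduct_mulVec_inv hC hu] using
    sq_dotProduct_mulVec_le hC hpos (C⁻¹ *ᵥ u) (C⁻¹ *ᵥ v)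

/-- Cauchy-Schwarz for `C⁻¹ u` and `u`; it serves to bound `1ᵀ C⁻¹ 1` from below. -/
lemma sq_dotProduct_self_le (hpos : ∀ x : ι → ℝ, 0 ≤ x ⬝ᵥ C *ᵥ x) (u : ι → ℝ) :
    (u ⬝ᵥ u) ^ 2 ≤ (u ⬝ᵥ C⁻¹ *ᵥ u) * (u ⬝ᵥ C *ᵥ u) := by
  have h := sq_dotProduct_mulVec_le hC hpos (C⁻¹ *ᵥ u) u
  rwa [inv_mulVec_dotProduct_mulVec_inv hC hu, inv_mulVec_dotProduct hC hu, mulVec_mulVec,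
    nonsing_inv_mul _ hu, one_mulVec] at h

/-- With `t = 1ᵀ C⁻¹ c`, `w = 1ᵀ C⁻¹ 1` and `s = (1 - t) / w`, the terms added to `cᵀ C⁻¹ c` are
`2st + s²w = s(1 + t)`. -/
lemma kriging_quadratic_form (c one : ι → ℝ) (h1 : one ⬝ᵥ C⁻¹ *ᵥ one ≠ 0) :
    (C⁻¹ *ᵥ c + ((1 - one ⬝ᵥ C⁻¹ *ᵥ c) / (one ⬝ᵥ C⁻¹ *ᵥ one)) • C⁻¹ *ᵥ one) ⬝ᵥ
      C *ᵥ (C⁻¹ *ᵥ c + ((1 - one ⬝ᵥ C⁻¹ *ᵥ c) / (one ⬝ᵥ C⁻¹ *ᵥ one)) • C⁻¹ *ᵥ one) =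
    c ⬝ᵥ C⁻¹ *ᵥ c + (1 - (one ⬝ᵥ C⁻¹ *ᵥ c) ^ 2) / (one ⬝ᵥ C⁻¹ *ᵥ one) := by
  have h2 : c ⬝ᵥ C⁻¹ *ᵥ one = one ⬝ᵥ C⁻¹ *ᵥ c := by
    rw [dotProduct_comm, inv_mulVec_dotProduct hC hu]
  simp only [mulVec_add, mulVec_smul, dotProduct_add, add_dotProduct, smul_dotProduct,
    dotProduct_smul, smul_eq_mul, inv_mulVec_dotProduct_mulVec_inv hC hu, h2]
  field_simp
  ring

end Inverse

end MatrixResolvent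

/-! ### Exact variance formulas, and the estimation part. -/

section Prediction

open Matrix

/-- The kriging variance as a function of three quadratic forms is uniformly continuous on the
relevant range. -/
lemma exists_kriging_formula_continuity {lam E w0 : ℝ} (hlam : 0 < lam) (hw0 : 0 < w0)
    {ε : ℝ} (hε : 0 < ε) :
    ∃ η : ℝ, 0 < η ∧ ∀ x t w x' t' w' : ℝ, |x| ≤ E → |t| ≤ E → w0 ≤ w → w ≤ E →
      |x' - x| < η → |t' - t| < η → |w' - w| < η →
      |(lam ^ 3 * x + (1 - (lam * t) ^ 2) / (w / lam)) -
        (lam ^ 3 * x' + (1 - (lam * t') ^ 2) / (w' / lam))| < ε := by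
  set F : ℝ × ℝ × ℝ → ℝ := fun p => lam ^ 3 * p.1 + (1 - (lam * p.2.1) ^ 2) / (p.2.2 / lam)
  -- The box is enlarged by 1, and its lower bound for `w` halved, so that it also contains the
  -- perturbed triples.
  set K : Set (ℝ × ℝ × ℝ) :=
    Set.Icc (-(E + 1)) (E + 1) ×ˢ Set.Icc (-(E + 1)) (E + 1) ×ˢ Set.Icc (w0 / 2) (E + 1)
  have hK : IsCompact K := isCompact_Icc.prod (isCompact_Icc.prod isCompact_Icc)
  have hF : ContinuousOn F K := by
    refine ContinuousOn.add (by fun_prop) (ContinuousOn.div (by fun_prop) (by fun_prop) ?_)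
    rintro ⟨x, t, w⟩ ⟨-, -, hw, -⟩
    have : 0 < w := by simp only at hw; linarith
    positivity
  obtain ⟨η, hη, h⟩ := Metric.uniformContinuousOn_iff.1
    (hK.uniformContinuousOn_of_continuous hF) ε hε
  refine ⟨min η (min 1 (w0 / 2)), by positivity, ?_⟩
  intro x t w x' t' w' hx ht hw hwE hx' ht' hw'
  simp only [lt_min_iff] at hx' ht' hw'
  have h1 := abs_le.1 hx
  have h2 := abs_le.1 ht
  have h3 := abs_lt.1 hx'.2.1
  have h4 := abs_lt.1 ht'.2.1
  have h5 := abs_lt.1 hw'.2.1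
  have h6 := abs_lt.1 hw'.2.2
  have hxK : (x, t, w) ∈ K := by
    simp only [K, Set.mem_prod, Set.mem_Icc]
    refine ⟨⟨?_, ?_⟩, ⟨?_, ?_⟩, ?_, ?_⟩ <;> linarith
  have hxK' : (x', t', w') ∈ K := by
    simp only [K, Set.mem_prod, Set.mem_Icc]
    refine ⟨⟨?_, ?_⟩, ⟨?_, ?_⟩, ?_, ?_⟩ <;> linarith
  have := h (x, t, w) hxK (x', t', w') hxK' (by
      rw [Prod.dist_eq, Prod.dist_eq, Real.dist_eq, Real.dist_eq, Real.dist_eq, abs_sub_comm x,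
        abs_sub_comm t, abs_sub_comm w]
      exact max_lt hx'.1 (max_lt ht'.1 hw'.1))
  rwa [Real.dist_eq] at this

/-- The excess over `lam / w` is `lam ^ 3 * (w * x - t ^ 2) / w`; the hypothesis is Cauchy-Schwarz
for the three forms. -/
lemma div_le_kriging_formula {lam x t w : ℝ} (hlam : 0 < lam) (hw : 0 < w) (h : t ^ 2 ≤ w * x) :
    lam / w ≤ lam ^ 3 * x + (1 - (lam * t) ^ 2) / (w / lam) := by
  have : lam ^ 3 * x + (1 - (lam * t) ^ 2) / (w / lam) = lam / w + lam ^ 3 * (w * x - t ^ 2) / w := by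
    field_simp; ring
  rw [this]
  have : 0 ≤ lam ^ 3 * (w * x - t ^ 2) / w :=
    div_nonneg (mul_nonneg (by positivity) (by linarith)) hw.le
  linarith

variable {Ω : Type*} [MeasurableSpace Ω] {P : Measure Ω} [IsProbabilityMeasure P]
  {Φ : PlanarPointProcess Ω} {lam : ℝ} {g : ℝ → ℝ} {M : ℝ} {δ : ℝ} {a : Plane}
  {I : Finset (ℤ × ℤ)}

lemma variance_weighted_counts (hlam : 0 < lam) (hg : Measurable g)
    (hg0 : ∀ r, 0 ≤ r → 0 ≤ g r) (hM : ∀ r, 0 ≤ r → |g r - 1| ≤ M)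
    (hΦ : Φ.HasIntensity P lam) (hΦ2 : Φ.HasPairCorrelation P lam g) (s : ℝ) (w : I → ℝ) :
    variance (fun ω => ∑ i : I, w i * (Φ.count (gridCell δ (gridNode δ a i)) ω / s)) P =
      (s ^ 2)⁻¹ * (w ⬝ᵥ covMatrix Φ P δ a I *ᵥ w) := by
  have hL : ∀ i : I, MemLp (Φ.count (gridCell δ (gridNode δ a i))) 2 P := fun i =>
    Φ.memLp_count hlam hg hg0 hM hΦ hΦ2 (isBounded_gridCell _ _) (measurableSet_gridCell _ _)
  have e : ∀ i : I, (fun ω => w i * (Φ.count (gridCell δ (gridNode δ a i)) ω / s)) =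
      fun ω => (w i / s) * Φ.count (gridCell δ (gridNode δ a i)) ω := fun i => by
    ext ω; ring
  rw [variance_fun_sum fun i => by rw [e]; exact (hL i).const_mul _]
  simp only [e, covariance_const_mul_left, covariance_const_mul_right, dotProduct, mulVec,
    covMatrix, Matrix.of_apply, Finset.mul_sum]
  refine Finset.sum_congr rfl fun i _ => Finset.sum_congr rfl fun j _ => ?_
  field_simp

lemma covMatrix_transpose : (covMatrix Φ P δ a I)ᵀ = covMatrix Φ P δ a I := by
  ext i j
  exact covariance_comm _ _

lemma covMatrix_nonneg (hlam : 0 < lam) (hg : Measurable g)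
    (hg0 : ∀ r, 0 ≤ r → 0 ≤ g r) (hM : ∀ r, 0 ≤ r → |g r - 1| ≤ M)
    (hΦ : Φ.HasIntensity P lam) (hΦ2 : Φ.HasPairCorrelation P lam g) (w : I → ℝ) :
    0 ≤ w ⬝ᵥ covMatrix Φ P δ a I *ᵥ w := by
  have h := variance_weighted_counts hlam hg hg0 hM hΦ hΦ2 (δ := δ) (a := a) 1 w
  rw [one_pow, inv_one, one_mul] at h
  exact h ▸ variance_nonneg _ _

/-- Here `C_o` is a column of `C`, so `C⁻¹ C_o` is a unit vector; its entries sum to one and the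
correction term vanishes. -/
lemma krigingWeights_gridNode (hC : IsUnit (covMatrix Φ P δ a I).det) (i : I) :
    krigingWeights Φ P δ a I (gridNode δ a i) = Pi.single i 1 := by
  have h1 : covVector Φ P δ a I (gridNode δ a i) = covMatrix Φ P δ a I *ᵥ Pi.single i 1 := by
    rw [mulVec_single_one]; rfl
  have h2 : (covMatrix Φ P δ a I)⁻¹ *ᵥ covVector Φ P δ a I (gridNode δ a i) = Pi.single i 1 := by
    rw [h1, mulVec_mulVec, nonsing_inv_mul _ hC, one_mulVec]
  simp [krigingWeights, h2, dotProduct_single]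

lemma variance_krigingInterpolator_gridNode (hlam : 0 < lam) (hg : Measurable g)
    (hg0 : ∀ r, 0 ≤ r → 0 ≤ g r) (hM : ∀ r, 0 ≤ r → |g r - 1| ≤ M)
    (hΦ : Φ.HasIntensity P lam) (hΦ2 : Φ.HasPairCorrelation P lam g) (hδ : 0 < δ)
    (hC : IsUnit (covMatrix Φ P δ a I).det) (i : I) :
    variance (krigingInterpolator Φ P δ a I (gridNode δ a i)) P / (lam / cellArea δ) =
      1 + cellArea δ * cellMean (corrKernel lam g) δ a i i := by
  have hb := cellArea_pos hδ
  unfold krigingInterpolator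
  rw [variance_weighted_counts hlam hg hg0 hM hΦ hΦ2, krigingWeights_gridNode hC,
    mulVec_single_one, single_one_dotProduct, col_apply,
    PlanarPointProcess.covMatrix_eq hlam hg hg0 hM hΦ hΦ2 hδ]
  simp only [Matrix.smul_apply, Matrix.add_apply, Matrix.one_apply_eq, Matrix.of_apply,
    smul_eq_mul]
  field_simp

theorem estimation_variance_tendsto (hlam : 0 < lam) (hg : Measurable g)
    (hg0 : ∀ r, 0 ≤ r → 0 ≤ g r) (hM1 : 1 ≤ M) (hM : ∀ r, 0 ≤ r → |g r - 1| ≤ M)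
    (hΦ : Φ.HasIntensity P lam) (hΦ2 : Φ.HasPairCorrelation P lam g) {ε : ℝ} (hε : 0 < ε) :
    ∃ δ₁ : ℝ, 0 < δ₁ ∧ ∀ (δ : ℝ) (a : Plane) (I : Finset (ℤ × ℤ)), 0 < δ → δ < δ₁ →
      IsUnit (covMatrix Φ P δ a I).det → ∀ i ∈ I,
        |variance (krigingInterpolator Φ P δ a I (gridNode δ a i)) P / (lam / cellArea δ) - 1|
          < ε := by
  -- The relative error is at most `δ ^ 2 * (lam * M)`.
  refine ⟨√(ε / (lam * M)), by positivity, fun δ a I hδ hlt hC i hi => ?_⟩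
  rw [variance_krigingInterpolator_gridNode hlam hg hg0 hM hΦ hΦ2 hδ hC ⟨i, hi⟩,
    add_sub_cancel_left, abs_mul, abs_of_pos (cellArea_pos hδ), cellArea_eq hδ]
  have h1 := abs_cellMean_le (a := a) hδ (measurable_corrKernel (lam := lam) hg)
    (abs_corrKernel_le hlam hM) i i
  have h2 : δ ^ 2 < ε / (lam * M) := by
    rw [← Real.sq_sqrt (show 0 ≤ ε / (lam * M) by positivity)]
    exact pow_lt_pow_left₀ hlt hδ.le two_ne_zero
  rw [lt_div_iff₀ (by positivity)] at h2
  exact (mul_le_mul_of_nonneg_left h1 (sq_nonneg δ)).trans_lt h2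

/-- The kriging variance outside the window, in terms of the inverse of the normalised covariance
matrix. -/
lemma variance_krigingInterpolator_eq (hlam : 0 < lam) (hg : Measurable g)
    (hg0 : ∀ r, 0 ≤ r → 0 ≤ g r) (hM : ∀ r, 0 ≤ r → |g r - 1| ≤ M)
    (hΦ : Φ.HasIntensity P lam) (hΦ2 : Φ.HasPairCorrelation P lam g) (hδ : 0 < δ)
    {A : Matrix I I ℝ} (hA : covMatrix Φ P δ a I = (lam * cellArea δ) • (1 + A))
    (hu : IsUnit (1 + A).det) {xo : Plane} (hxo : Disjoint (gridCell δ xo) (gridWindow δ a I))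
    (h1 : (fun _ => 1 : I → ℝ) ⬝ᵥ (1 + A)⁻¹ *ᵥ (fun _ => 1) ≠ 0) :
    variance (krigingInterpolator Φ P δ a I xo) P =
      lam ^ 3 * (cellArea δ * (pairVector g δ a I xo ⬝ᵥ (1 + A)⁻¹ *ᵥ pairVector g δ a I xo)) +
      (1 - (lam * (cellArea δ * ((fun _ => 1 : I → ℝ) ⬝ᵥ
        (1 + A)⁻¹ *ᵥ pairVector g δ a I xo))) ^ 2) /
      (cellArea δ * ((fun _ => 1 : I → ℝ) ⬝ᵥ (1 + A)⁻¹ *ᵥ (fun _ => 1)) / lam) := by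
  have hb := (cellArea_pos hδ)
  have hk : lam * cellArea δ ≠ 0 := by positivity
  have hinv : (covMatrix Φ P δ a I)⁻¹ = (lam * cellArea δ)⁻¹ • (1 + A)⁻¹ := by
    rw [hA]; exact Matrix.inv_smul' _ (Units.mk0 _ hk) hu
  have hCu : IsUnit (covMatrix Φ P δ a I).det := by
    rw [hA, det_smul]; exact (IsUnit.mk0 _ (pow_ne_zero _ hk)).mul hu
  have h2 : (fun _ => 1 : I → ℝ) ⬝ᵥ (covMatrix Φ P δ a I)⁻¹ *ᵥ (fun _ => 1) ≠ 0 := by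
    rw [hinv, smul_mulVec, dotProduct_smul, smul_eq_mul]
    exact mul_ne_zero (inv_ne_zero hk) h1
  unfold krigingInterpolator
  rw [variance_weighted_counts hlam hg hg0 hM hΦ hΦ2]
  simp only [krigingWeights]
  rw [kriging_quadratic_form covMatrix_transpose hCu _ _ h2, hinv,
    PlanarPointProcess.covVector_eq hlam hg hg0 hM hΦ hΦ2 hδ hxo]
  simp only [smul_mulVec, mulVec_smul, dotProduct_smul, smul_dotProduct, smul_eq_mul]
  field_simp

lemma predictionVariance_eq (hlam : 0 < lam) (hδ : 0 < δ) (xo : Plane) {L : Matrix I I ℝ}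
    (hL : L = (lam * cellArea δ) • neumannMatrix lam g δ a I) :
    predictionVariance lam g δ a I xo =
      lam ^ 3 * (cellArea δ * (pairVector g δ a I xo ⬝ᵥ (1 + L) *ᵥ pairVector g δ a I xo)) +
      (1 - (lam * (cellArea δ * ((fun _ => 1 : I → ℝ) ⬝ᵥ
        (1 + L) *ᵥ pairVector g δ a I xo))) ^ 2) /
      (cellArea δ * ((fun _ => 1 : I → ℝ) ⬝ᵥ (1 + L) *ᵥ (fun _ => 1)) / lam) := by
  have h1 : (fun _ => 1 : I → ℝ) ⬝ᵥ (fun _ => 1) = I.card := by simp [dotProduct]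
  simp only [predictionVariance, hL, add_mulVec, one_mulVec, smul_mulVec, dotProduct_add,
    dotProduct_smul, smul_eq_mul, h1, measureReal_gridWindow hδ]
  congr 1
  · ring
  · congr 1
    · ring
    · field_simp

end Prediction

/-! ### The prediction part: uniform bounds and passage to the limit. -/

section PredictionLimit

open Matrix

lemma sum_sum_sq_le {ι : Type*} [Fintype ι] {X : Matrix ι ι ℝ} {c : ℝ}
    (hX : ∀ i j, |X i j| ≤ c) : ∑ i, ∑ j, X i j ^ 2 ≤ (Fintype.card ι * c) ^ 2 := by
  calc ∑ i, ∑ j, X i j ^ 2 ≤ ∑ _i : ι, ∑ _j : ι, c ^ 2 :=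
        Finset.sum_le_sum fun i _ => Finset.sum_le_sum fun j _ => by
          rw [← sq_abs]; exact pow_le_pow_left₀ (abs_nonneg _) (hX i j) 2
    _ = _ := by simp; ring

lemma gridDefect_matrix_mul (κ ρ : Plane → Plane → ℝ) (δ : ℝ) (a : Plane) (I : Finset (ℤ × ℤ)) :
    (1 + Matrix.of fun i j : I => cellArea δ * cellMean κ δ a i j) *
      (1 + Matrix.of fun i j : I => cellArea δ * ρ (gridNode δ a i) (gridNode δ a j)) =
    1 + Matrix.of fun i j : I => cellArea δ * gridDefect κ ρ δ a I i j := by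
  rw [add_mul, one_mul, mul_add, mul_one, add_assoc]
  congr 1
  ext i j
  simp only [Matrix.add_apply, Matrix.of_apply, Matrix.mul_apply, gridDefect]
  have h : ∑ l : I, cellArea δ * cellMean κ δ a i l *
      (cellArea δ * ρ (gridNode δ a l) (gridNode δ a j)) = cellArea δ * (cellArea δ *
        ∑ l ∈ I, cellMean κ δ a i l * ρ (gridNode δ a l) (gridNode δ a j)) := by
    rw [← Finset.sum_coe_sort I fun l => cellMean κ δ a i l * ρ (gridNode δ a l) (gridNode δ a j),
      Finset.mul_sum, Finset.mul_sum]
    exact Finset.sum_congr rfl fun l _ => by ring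
  rw [h]
  ring

variable {Ω : Type*} [MeasurableSpace Ω] {P : Measure Ω} [IsProbabilityMeasure P]
  {Φ : PlanarPointProcess Ω} {lam : ℝ} {g : ℝ → ℝ} {M : ℝ}

/-- Bounds for the quadratic forms of the kriging variance on a grid with small defect. -/
lemma kriging_forms_bounds {n : ℕ} {ι : Type*} [Fintype ι] [DecidableEq ι]
    (hn : Fintype.card ι = n) (hn0 : 0 < n) {b ν : ℝ} (hb : 0 < b) (hν : n * b = ν)
    {A L N : Matrix ι ι ℝ} {l lA ρ : ℝ} (hM1 : 1 ≤ M)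
    (hA : Aᵀ = A) (hmul : (1 + A) * (1 + L) = 1 + N)
    (hpos : ∀ x : ι → ℝ, 0 ≤ x ⬝ᵥ (1 + A) *ᵥ x)
    (hl : 0 ≤ l) (hL : ∑ i, ∑ j, L i j ^ 2 ≤ l ^ 2)
    (hlA : 0 ≤ lA) (hA2 : ∑ i, ∑ j, A i j ^ 2 ≤ lA ^ 2) (hρ : 0 ≤ ρ) (hρ2 : ρ ≤ 1 / 2)
    (hN : ∑ i, ∑ j, N i j ^ 2 ≤ ρ ^ 2) :
    (∀ u v : ι → ℝ, (∀ i, |u i| ≤ M) → (∀ i, |v i| ≤ M) →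
      |b * (u ⬝ᵥ (1 + A)⁻¹ *ᵥ v)| ≤ 2 * (1 + l) * M ^ 2 * ν ∧
      |b * (u ⬝ᵥ (1 + L) *ᵥ v) - b * (u ⬝ᵥ (1 + A)⁻¹ *ᵥ v)| ≤ 2 * (1 + l) * M ^ 2 * ν * ρ) ∧
    ν / (1 + lA) ≤ b * ((fun _ => 1 : ι → ℝ) ⬝ᵥ (1 + A)⁻¹ *ᵥ (fun _ => 1)) := by
  have hM0 : 0 ≤ M := by linarith
  have hnb : 0 < (n : ℝ) := by exact_mod_cast hn0
  have hA1 : (1 + A)ᵀ = 1 + A := by rw [transpose_add, hA, transpose_one]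
  have hu := isUnit_det_one_add hA hmul hl hL hρ hρ2 hN
  constructor
  · intro u v hu' hv'
    have h1 := sqrt_dotProduct_self_le hM0 hu'
    have h2 := sqrt_dotProduct_self_le hM0 hv'
    rw [hn] at h1 h2
    have h3 : √(u ⬝ᵥ u) * √(v ⬝ᵥ v) ≤ M ^ 2 * n := by
      refine (mul_le_mul h1 h2 (Real.sqrt_nonneg _) (by positivity)).trans_eq ?_
      rw [mul_mul_mul_comm, Real.mul_self_sqrt hnb.le]; ring
    constructor
    · rw [abs_mul, abs_of_pos hb]
      calc _ ≤ b * (2 * (1 + l) * (M ^ 2 * n)) := by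
            refine mul_le_mul_of_nonneg_left ?_ hb.le
            exact (abs_dotProduct_inv_mulVec_le hA hmul hl hL hρ hρ2 hN u v).trans
              (mul_le_mul_of_nonneg_left h3 (by positivity))
        _ = _ := by rw [← hν]; ring
    · rw [← mul_sub, abs_mul, abs_of_pos hb]
      calc _ ≤ b * (2 * (1 + l) * ρ * (M ^ 2 * n)) := by
            refine mul_le_mul_of_nonneg_left ?_ hb.le
            exact (abs_dotProduct_sub_inv_mulVec_le hA hmul hl hL hρ hρ2 hN u v).trans
              (mul_le_mul_of_nonneg_left h3 (by positivity))
        _ = _ := by rw [← hν]; ring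
  · set one : ι → ℝ := fun _ => 1
    have h1 : one ⬝ᵥ one = n := by simp [one, dotProduct, hn]
    -- The form of `1 + A` at `one` is at most `n * (1 + lA)`, so that of its inverse is at least `n
    -- / (1 + lA)`.
    have h2 := sq_dotProduct_self_le hA1 hu hpos one
    have h3 : one ⬝ᵥ (1 + A) *ᵥ one ≤ n * (1 + lA) := by
      have := (abs_le.1 (abs_dotProduct_mulVec_le hlA hA2 one one)).2
      rw [Real.mul_self_sqrt (by rw [h1]; exact hnb.le), h1] at this
      rw [add_mulVec, one_mulVec, dotProduct_add, h1]
      linarith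
    have h4 : 0 ≤ one ⬝ᵥ (1 + A)⁻¹ *ᵥ one := by
      rw [← inv_mulVec_dotProduct_mulVec_inv hA1 hu]; exact hpos _
    have h5 := h2.trans (mul_le_mul_of_nonneg_left h3 h4)
    rw [h1] at h5
    have h6 : (n : ℝ) ≤ (one ⬝ᵥ (1 + A)⁻¹ *ᵥ one) * (1 + lA) :=
      le_of_mul_le_mul_right (by linarith) hnb
    rw [div_le_iff₀ (by positivity), ← hν]
    nlinarith

theorem prediction_variance_tendsto (hlam : 0 < lam) (hg : Measurable g)
    (hg0 : ∀ r, 0 ≤ r → 0 ≤ g r) (hM1 : 1 ≤ M) (hM : ∀ r, 0 ≤ r → |g r - 1| ≤ M)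
    (hcont : ∀ᵐ z : Plane, ContinuousAt (fun w : Plane => g ‖w‖) z)
    (hΦ : Φ.HasIntensity P lam) (hΦ2 : Φ.HasPairCorrelation P lam g) {S : Set Plane}
    (hS : S.Nonempty) (hsum : ∀ y ∈ S, ∀ z ∈ S, Summable (neumannTerm lam g S y z))
    {ε : ℝ} (hε : 0 < ε) :
    ∃ δ₀ : ℝ, 0 < δ₀ ∧
      ∀ (δ : ℝ) (a : Plane) (I : Finset (ℤ × ℤ)), 0 < δ → δ < δ₀ → gridWindow δ a I = S →
        IsUnit (covMatrix Φ P δ a I).det ∧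
        ∀ xo : Plane, Disjoint (gridCell δ xo) S →
          |variance (krigingInterpolator Φ P δ a I xo) P -
              predictionVariance lam g δ a I xo| < ε ∧
          |variance (krigingInterpolator Φ P δ a I xo) P -
              predictionVariance lam g δ a I xo| <
            ε * variance (krigingInterpolator Φ P δ a I xo) P := by
  -- Without a grid that fits `S` the claim is vacuous; with one, `S` is bounded and measurable of
  -- positive area.
  by_cases hex : ∃ (δ : ℝ) (a : Plane) (I : Finset (ℤ × ℤ)), 0 < δ ∧ gridWindow δ a I = S
  swap
  · exact ⟨1, one_pos, fun δ a I hδ _ hw => absurd ⟨δ, a, I, hδ, hw⟩ hex⟩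
  have hcard : ∀ {δ : ℝ} {a : Plane} {I : Finset (ℤ × ℤ)}, 0 < δ → gridWindow δ a I = S →
      0 < I.card ∧ I.card * cellArea δ = volume.real S := fun {δ a I} hδ hw => by
    refine ⟨?_, by rw [← hw, measureReal_gridWindow hδ]⟩
    obtain ⟨y, hy⟩ := hS
    rw [← hw, mem_gridWindow hδ] at hy
    exact Finset.card_pos.2 ⟨_, hy⟩
  have hmS : MeasurableSet S := by
    obtain ⟨δ, a, I, -, rfl⟩ := hex; exact measurableSet_gridWindow
  have hfin : IsFiniteMeasure (volume.restrict S) := by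
    obtain ⟨δ, a, I, -, rfl⟩ := hex; exact isBounded_gridWindow.isFiniteMeasure_restrict
  set ν := volume.real S
  have hν : 0 < ν := by
    obtain ⟨δ, a, I, hδ, hw⟩ := hex
    obtain ⟨h1, h2⟩ := hcard hδ hw
    have := cellArea_pos hδ
    rw [← h2]; positivity
  obtain ⟨D, q, hκ⟩ := exists_geometricKernel hlam hg hM hmS hsum
  set K : ℝ := D * (1 - q)⁻¹
  have hK : 0 ≤ K := (abs_nonneg _).trans (hκ.abs_resolvent_le 0 0)
  set l : ℝ := ν * K
  set lA : ℝ := ν * (lam * M)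
  have hl : 0 ≤ l := by positivity
  have hlA : 0 ≤ lA := by positivity
  set E : ℝ := 2 * (1 + l) * M ^ 2 * ν
  have hE : 0 < E := by positivity
  set w0 : ℝ := ν / (1 + lA)
  have hw0 : 0 < w0 := by positivity
  -- The second tolerance serves the relative estimate, as the variance is at least `lam / E`.
  obtain ⟨η, hη, hform⟩ := exists_kriging_formula_continuity (E := E) hlam hw0
    (show 0 < min ε (ε * (lam / E)) by positivity)
  -- The bound `1 / 2` gives invertibility; the other makes the error `E * ρ` of each form less than
  -- `η`.
  set ρ : ℝ := min (1 / 2) (η / (2 * E))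
  have hρ : 0 < ρ := by positivity
  have hρ2 : ρ ≤ 1 / 2 := min_le_left _ _
  have hρη : E * ρ < η := by
    have h1 : ρ ≤ η / (2 * E) := min_le_right _ _
    calc E * ρ ≤ E * (η / (2 * E)) := mul_le_mul_of_nonneg_left h1 hE.le
      _ = η / 2 := by field_simp
      _ < η := by linarith
  obtain ⟨δ₀, hδ₀, hdef⟩ := exists_gridDefect_lt hκ (ae_continuousAt_corrKernel hcont)
    (show 0 < ρ ^ 2 by positivity)
  refine ⟨δ₀, hδ₀, fun δ a I hδ hlt hw => ?_⟩
  have hb := cellArea_pos hδ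
  obtain ⟨hn0, hnν⟩ := hcard hδ hw
  set A : Matrix I I ℝ :=
    Matrix.of fun i j : I => cellArea δ * cellMean (corrKernel lam g) δ a i j with hAdef
  set L : Matrix I I ℝ := Matrix.of fun i j : I => cellArea δ *
    kernelResolvent (volume.restrict S) (corrKernel lam g) (gridNode δ a i) (gridNode δ a j)
    with hLdef
  set N : Matrix I I ℝ := Matrix.of fun i j : I => cellArea δ *
    gridDefect (corrKernel lam g) (kernelResolvent (volume.restrict S) (corrKernel lam g)) δ a I i j
    with hNdef
  have hmul : (1 + A) * (1 + L) = 1 + N := gridDefect_matrix_mul _ _ _ _ _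
  have hC : covMatrix Φ P δ a I = (lam * cellArea δ) • (1 + A) :=
    PlanarPointProcess.covMatrix_eq hlam hg hg0 hM hΦ hΦ2 hδ
  have hk : 0 < lam * cellArea δ := by positivity
  have hCA : 1 + A = (lam * cellArea δ)⁻¹ • covMatrix Φ P δ a I := by
    rw [hC, smul_smul, inv_mul_cancel₀ hk.ne', one_smul]
  have hA1 : (1 + A)ᵀ = 1 + A := by rw [hCA, transpose_smul, covMatrix_transpose]
  have hA : Aᵀ = A := by
    rw [transpose_add, transpose_one] at hA1
    exact add_left_cancel hA1
  have hpos : ∀ x : I → ℝ, 0 ≤ x ⬝ᵥ (1 + A) *ᵥ x := fun x => by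
    rw [hCA, smul_mulVec, dotProduct_smul, smul_eq_mul]
    exact mul_nonneg (by positivity) (covMatrix_nonneg hlam hg hg0 hM hΦ hΦ2 x)
  have hL2 : ∑ i, ∑ j, L i j ^ 2 ≤ l ^ 2 := by
    refine (sum_sum_sq_le (c := cellArea δ * K) fun i j => ?_).trans_eq ?_
    · rw [hLdef, Matrix.of_apply, abs_mul, abs_of_pos hb]
      exact mul_le_mul_of_nonneg_left (hκ.abs_resolvent_le _ _) hb.le
    · rw [Fintype.card_coe, ← mul_assoc, hnν]
  have hA2 : ∑ i, ∑ j, A i j ^ 2 ≤ lA ^ 2 := by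
    refine (sum_sum_sq_le (c := cellArea δ * (lam * M)) fun i j => ?_).trans_eq ?_
    · rw [hAdef, Matrix.of_apply, abs_mul, abs_of_pos hb]
      exact mul_le_mul_of_nonneg_left (abs_cellMean_le hδ hκ.measurable hκ.bound _ _) hb.le
    · rw [Fintype.card_coe, ← mul_assoc, hnν]
  have hN2 : ∑ i, ∑ j, N i j ^ 2 ≤ ρ ^ 2 := by
    refine le_of_eq_of_le ?_ (hdef δ a I hδ hlt hw).le
    simp only [hNdef, Matrix.of_apply, mul_pow, ← Finset.mul_sum]
    rw [← Finset.sum_coe_sort I]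
    simp only [← Finset.sum_coe_sort I]
  have hu : IsUnit (1 + A).det := isUnit_det_one_add hA hmul hl hL2 hρ.le hρ2 hN2
  refine ⟨by rw [hC, det_smul]; exact (IsUnit.mk0 _ (pow_ne_zero _ hk.ne')).mul hu,
    fun xo hxo => ?_⟩
  obtain ⟨hforms, hlow⟩ := kriging_forms_bounds (Fintype.card_coe I) hn0 hb hnν hM1 hA hmul hpos
    hl hL2 hlA hA2 hρ.le hρ2 hN2
  set one : I → ℝ := fun _ => 1
  set d := pairVector g δ a I xo
  have hone : ∀ i, |one i| ≤ M := fun i => by simpa [one] using hM1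
  have hd : ∀ i, |d i| ≤ M := PlanarPointProcess.abs_pairVector_le hg hM hδ xo
  have hw_pos : 0 < cellArea δ * (one ⬝ᵥ (1 + A)⁻¹ *ᵥ one) := hw0.trans_le hlow
  have hLJ : L = (lam * cellArea δ) • neumannMatrix lam g δ a I := by
    ext i j
    rw [hLdef, Matrix.of_apply, Matrix.smul_apply, smul_eq_mul, mul_comm lam, mul_assoc,
      mul_neumannMatrix, hw]
  have hvar := variance_krigingInterpolator_eq hlam hg hg0 hM hΦ hΦ2 hδ hC hu (hw.symm ▸ hxo)
    (right_ne_zero_of_mul hw_pos.ne')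
  have hpred := predictionVariance_eq (g := g) (a := a) hlam hδ xo hLJ
  have hwE : cellArea δ * (one ⬝ᵥ (1 + A)⁻¹ *ᵥ one) ≤ E :=
    (le_abs_self _).trans (hforms one one hone hone).1
  have hmain := hform _ _ _ _ _ _ (hforms d d hd hd).1 (hforms one d hone hd).1 hlow hwE
    ((hforms d d hd hd).2.trans_lt hρη) ((hforms one d hone hd).2.trans_lt hρη)
    ((hforms one one hone hone).2.trans_lt hρη)
  have hge : lam / E ≤ variance (krigingInterpolator Φ P δ a I xo) P := by
    rw [hvar]
    refine le_trans ?_ (div_le_kriging_formula hlam hw_pos ?_)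
    · exact div_le_div_of_nonneg_left hlam.le hw_pos hwE
    · have := sq_dotProduct_inv_mulVec_le hA1 hu hpos one d
      rw [mul_pow, mul_mul_mul_comm, ← sq]
      exact mul_le_mul_of_nonneg_left this (sq_nonneg _)
  rw [← hvar, ← hpred, lt_min_iff] at hmain
  exact ⟨hmain.1, hmain.2.trans_le (mul_le_mul_of_nonneg_left hge hε.le)⟩

end PredictionLimit

theorem mainTheorem3 {Ω : Type*} [MeasurableSpace Ω] (P : Measure Ω) [IsProbabilityMeasure P]
    (Φ : PlanarPointProcess Ω) (lam : ℝ) (hlam : 0 < lam) (g : ℝ → ℝ)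
    (hg_meas : Measurable g) (hg_nonneg : ∀ r, 0 ≤ r → 0 ≤ g r)
    (hg_bdd : ∃ M, ∀ r, 0 ≤ r → g r ≤ M)
    (hg_cont : ∀ᵐ z : Plane, ContinuousAt (fun w : Plane => g ‖w‖) z)
    (hΦ_int : Φ.HasIntensity P lam) (hΦ_pair : Φ.HasPairCorrelation P lam g) :
    -- at a point of the grid inside the window, uniformly over all grids and windows
    (∀ ε : ℝ, 0 < ε → ∃ δ₁ : ℝ, 0 < δ₁ ∧
      ∀ (δ : ℝ) (a : Plane) (I : Finset (ℤ × ℤ)), 0 < δ → δ < δ₁ →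
        IsUnit (covMatrix Φ P δ a I).det → ∀ i ∈ I,
          |variance (krigingInterpolator Φ P δ a I (gridNode δ a i)) P / (lam / cellArea δ) - 1|
            < ε) ∧
    -- for a given window on which the series converges
    (∀ S : Set Plane, S.Nonempty →
      (∀ y ∈ S, ∀ z ∈ S, Summable (neumannTerm lam g S y z)) →
      ∀ ε : ℝ, 0 < ε → ∃ δ₀ : ℝ, 0 < δ₀ ∧
        ∀ (δ : ℝ) (a : Plane) (I : Finset (ℤ × ℤ)), 0 < δ → δ < δ₀ → gridWindow δ a I = S →
          IsUnit (covMatrix Φ P δ a I).det ∧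
          ∀ xo : Plane, Disjoint (gridCell δ xo) S →
            |variance (krigingInterpolator Φ P δ a I xo) P -
                predictionVariance lam g δ a I xo| < ε ∧
            |variance (krigingInterpolator Φ P δ a I xo) P -
                predictionVariance lam g δ a I xo| <
              ε * variance (krigingInterpolator Φ P δ a I xo) P) := by
  obtain ⟨M, hM1, hM⟩ := exists_abs_sub_one_le hg_nonneg hg_bdd
  exact ⟨fun ε hε =>
      estimation_variance_tendsto hlam hg_meas hg_nonneg hM1 hM hΦ_int hΦ_pair hε,
    fun S hS hsum ε hε => prediction_variance_tendsto hlam hg_meas hg_nonneg hM1 hM hg_cont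
      hΦ_int hΦ_pair hS hsum hε⟩
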